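/- Let $S^1=\{\omega\in\mathbb R^2:|\omega|=1\}$, $\omega=(\cos\theta,\sin\theta)$, and let $\mathscr C=S^1\times\mathbb R\ni(\omega,v)$ be the cylinder. For a smooth function $h:\mathscr C\to\mathbb C$ put $$Rh(t,x)=\frac1{2\pi}\int_0^{2\pi}h(\omega,t+\langle\omega,x\rangle)\,d\theta\qquad(t\in\mathbb R,\ x\in\mathbb R^2).$$ For a Schwartz function $f$ on $\mathbb R^2$ let $\hat f(\omega,v)=\int_{\{x:\langle\omega,x\rangle=v\}}f\,dm$ be its Radon transform, where $dm$ is the length measure on the line, and for a function $g$ on $\mathscr C$ let $$\mathcal H_vg(\omega,v)=\frac i\pi\,\mathrm{p.v.}\!\int_{-\infty}^{\infty}\frac{g(\omega,\nu)}{v-\nu}\,d\nu$$ be its Hilbert transform in $v$. Theorem. Let $u:\mathbb R\times\mathbb R^2\to\mathbb C$ be a smooth solution of the wave equation $\Box u=u_{tt}-u_{x_1x_1}-u_{x_2x_2}=0$ on $\mathbb R^{1,2}$ whose Cauchy data $f_0(x)=u(0,x)$ and $f_1(x)=u_t(0,x)$ are rapidly decreasing (Schwartz) functions on $\mathbb R^2$.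 Then the principal value defining $$h=\frac1{2i}\,\mathcal H_v\bigl(\partial_v\hat f_0+\hat f_1\bigr)$$ exists at every point of $\mathscr C$, the function $h$ is smooth on $\mathscr C$, for all integers $k,l,m\ge0$ with $k\le l+1$ $$\sup_{(\omega,v)\in\mathscr C}\ (1+|v|^k)\,\bigl|\partial_v^l\,\partial_\theta^m h(\omega,v)\bigr|<\infty,$$ and $u=Rh$ on $\mathbb R\times\mathbb R^2$. -/

import Mathlib

open MeasureTheory Filter Topology
open scoped ContDiff Manifold

namespace CylinderWave

noncomputable section

/-- The Euclidean plane. -/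
abbrev Plane : Type := EuclideanSpace ℝ (Fin 2)

/-- The point `ζ = (cos θ, sin θ)` of the plane given by the complex number `ζ = e ^ (i θ)`. -/
def dir (ζ : Circle) : Plane := !₂[(ζ : ℂ).re, (ζ : ℂ).im]

/-- The unit vector obtained from `dir ζ` by a quarter turn: the direction of the lines
`{x | ⟪ζ, x⟫ = v}`. -/
def dirPerp (ζ : Circle) : Plane := !₂[-(ζ : ℂ).im, (ζ : ℂ).re]

/-- The wave operator `□ u = ∂²u/∂t² - ∂²u/∂x₁² - ∂²u/∂x₂²` on `ℝ × ℝ²`. -/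
def waveOp (u : ℝ × Plane → ℂ) (t : ℝ) (x : Plane) : ℂ :=
  iteratedDeriv 2 (fun s : ℝ => u (s, x)) t -
    Laplacian.laplacian (fun y : Plane => u (t, y)) x

/-- The integral transform `R`: the mean over `θ` of a function on the cylinder `S¹ × ℝ` along the
planar circle `v = t + ⟪ζ, x⟫`. -/
def circleTransform (h : Circle × ℝ → ℂ) (t : ℝ) (x : Plane) : ℂ :=
  (1 / (2 * Real.pi) : ℂ) * ∫ θ in (0 : ℝ)..(2 * Real.pi),
    h (Circle.exp θ, t + inner ℝ (dir (Circle.exp θ)) x)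

/-- The Radon transform: the integral of `f` over the line `{x | ⟪ζ, x⟫ = v}`, which
`s ↦ v ζ + s ζ^⊥` parametrizes by arc length. -/
def radon (f : Plane → ℂ) (ζ : Circle) (v : ℝ) : ℂ :=
  ∫ s : ℝ, f (v • dir ζ + s • dirPerp ζ)

/-- The integral of `g ν / (v - ν)` over `|ν - v| > ε`. -/
def truncatedHilbert (g : ℝ → ℂ) (v ε : ℝ) : ℂ :=
  ∫ ν in {ν : ℝ | ε < |ν - v|}, g ν / ((v : ℂ) - ν)

/-- The principal value integral of `g ν / (v - ν)` over `ν ∈ ℝ` exists and equals `L`. -/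
def HasPrincipalValue (g : ℝ → ℂ) (v : ℝ) (L : ℂ) : Prop :=
  (∀ ε : ℝ, 0 < ε → IntegrableOn (fun ν : ℝ => g ν / ((v : ℂ) - ν)) {ν : ℝ | ε < |ν - v|}) ∧
    Tendsto (truncatedHilbert g v) (𝓝[>] 0) (𝓝 L)

/-- The Hilbert transform in the variable `v` of a function on the cylinder:
`(i / π) pv ∫ g(ζ, ν) / (v - ν) dν`. -/
def hilbert (g : Circle → ℝ → ℂ) (ζ : Circle) (v : ℝ) : ℂ :=
  Complex.I / Real.pi * limUnder (𝓝[>] (0 : ℝ)) (truncatedHilbert (g ζ) v)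

/-- Smooth functions on the cylinder `S¹ × ℝ`. -/
def SmoothOnCylinder (h : Circle × ℝ → ℂ) : Prop :=
  ContMDiff ((𝓡 1).prod 𝓘(ℝ, ℝ)) 𝓘(ℝ, ℂ) ∞ h

/-- `(1 + |v| ^ k) ∂_v ^ l ∂_θ ^ m h` is bounded on the cylinder. -/
def WeightedBound (h : Circle × ℝ → ℂ) (k l m : ℕ) : Prop :=
  ∃ C : ℝ, ∀ θ v : ℝ,
    (1 + |v| ^ k) *
      ‖iteratedDeriv l (fun w : ℝ => iteratedDeriv m (fun φ : ℝ => h (Circle.exp φ, w)) θ) v‖ ≤ C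

end

end CylinderWave

open scoped SchwartzMap

/-! Write `T f` for `hilbertRadon f`, the principal value integral of the Radon transform of `f`
against `1 / (v - ν)`. Averaging the substitutions `ν = v - s` and `ν = v + s` turns it into the
absolutely convergent integral `symHilbert`. Since `(1 / 2i)(i / π) = 1 / (2π)`, the function `h` is
`1 / (2π)` times `T (f₁ + D_θ f₀)`, where `D_θ` is `dirDeriv θ`.

Regularity and decay come from moving operators onto the Schwartz function. On `T f`, `∂_v` acts as
`D_θ`, `∂_θ` acts as the rotation field `rotDeriv`, and multiplication by `v` acts as `dirMul θ`
plus the constant `∫ f̂` (`mul_hilbertRadon`). After a `v`-derivative this constant vanishes, so `v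
^ l ∂_v ^ l T f` is again `T` of a family of Schwartz functions bounded uniformly in the angle. One
further factor `v` costs only a bounded constant, which is where `k ≤ l + 1` comes from.

For `u = Rh`, a superposition of plane waves in `t + ⟪ω, x⟫` solves the wave equation, so it is
enough to compare Cauchy data. Radon inversion (`integral_hilbertRadon_dirDeriv`) says that the
angular integral of `T (D_θ f)` at `⟪ω, x⟫` is `4π² f x`. The antipodal map changes the sign of `T
f`, so the integral vanishes when `f`, or a family even in `ω`, replaces `D_θ f`
(`integral_hilbertRadon_eq_zero`). At `t = 0` the `f₁` term therefore drops out of the value and the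
`f₀` term out of the time derivative. A weighted energy estimate (`energy_identity_nonpos`,
`eq_zero_of_waveOp_eq_zero`) gives uniqueness. -/

namespace CylinderWave

noncomputable section

/-! ### Rotating frames and first-order operators on Schwartz functions -/

/-- The unit vector `(cos θ, sin θ)`. -/
def unitVec (θ : ℝ) : Plane := !₂[Real.cos θ, Real.sin θ]

/-- The unit vector `(-sin θ, cos θ)`. -/
def unitPerp (θ : ℝ) : Plane := !₂[-Real.sin θ, Real.cos θ]

lemma dir_exp (θ : ℝ) : dir (Circle.exp θ) = unitVec θ := by
  simp [dir, unitVec, Circle.coe_exp, Complex.exp_ofReal_mul_I_re, Complex.exp_ofReal_mul_I_im]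

lemma dirPerp_exp (θ : ℝ) : dirPerp (Circle.exp θ) = unitPerp θ := by
  simp [dirPerp, unitPerp, Circle.coe_exp, Complex.exp_ofReal_mul_I_re,
    Complex.exp_ofReal_mul_I_im]

/-- The point of the plane with coordinates `(v, s)` in the frame rotated by `θ`. -/
def linePoint (θ v s : ℝ) : Plane := v • unitVec θ + s • unitPerp θ

lemma linePoint_apply_zero (θ v s : ℝ) :
    linePoint θ v s 0 = v * Real.cos θ - s * Real.sin θ := by
  simp [linePoint, unitVec, unitPerp]; ring

lemma linePoint_apply_one (θ v s : ℝ) :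
    linePoint θ v s 1 = v * Real.sin θ + s * Real.cos θ := by
  simp [linePoint, unitVec, unitPerp]

lemma norm_sq_linePoint (θ v s : ℝ) : ‖linePoint θ v s‖ ^ 2 = v ^ 2 + s ^ 2 := by
  rw [EuclideanSpace.norm_sq_eq, Fin.sum_univ_two, Real.norm_eq_abs, Real.norm_eq_abs, sq_abs,
    sq_abs, linePoint_apply_zero, linePoint_apply_one]
  linear_combination (v ^ 2 + s ^ 2) * Real.sin_sq_add_cos_sq θ

lemma continuous_unitVec : Continuous unitVec := by
  unfold unitVec
  refine (PiLp.continuous_toLp 2 _).comp (continuous_pi fun i => ?_)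
  fin_cases i <;> simp <;> fun_prop

lemma continuous_unitPerp : Continuous unitPerp := by
  unfold unitPerp
  refine (PiLp.continuous_toLp 2 _).comp (continuous_pi fun i => ?_)
  fin_cases i <;> simp <;> fun_prop

@[fun_prop]
lemma Continuous.linePoint {X : Type*} [TopologicalSpace X] {a b c : X → ℝ} (ha : Continuous a)
    (hb : Continuous b) (hc : Continuous c) : Continuous fun x => linePoint (a x) (b x) (c x) :=
  (hb.smul (continuous_unitVec.comp ha)).add (hc.smul (continuous_unitPerp.comp ha))

/-- The partial derivative of a Schwartz function on the plane. -/
def pderiv (i : Fin 2) : 𝓢(Plane, ℂ) →L[ℝ] 𝓢(Plane, ℂ) :=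
  LineDeriv.lineDerivOpCLM ℝ _ (EuclideanSpace.single i (1 : ℝ))

/-- Multiplication of a Schwartz function on the plane by a coordinate. -/
def coordMul (i : Fin 2) : 𝓢(Plane, ℂ) →L[ℝ] 𝓢(Plane, ℂ) :=
  SchwartzMap.smulLeftCLM ℂ fun x : Plane => x i

lemma coordMul_apply (i : Fin 2) (f : 𝓢(Plane, ℂ)) (x : Plane) :
    coordMul i f x = (x i : ℂ) * f x := by
  have h : Function.HasTemperateGrowth fun x : Plane => x i :=
    (EuclideanSpace.proj i : Plane →L[ℝ] ℝ).hasTemperateGrowth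
  simp [coordMul, SchwartzMap.smulLeftCLM_apply_apply h]

lemma fderiv_schwartz_apply (f : 𝓢(Plane, ℂ)) (x y : Plane) :
    fderiv ℝ f x y = (y 0 : ℂ) * pderiv 0 f x + (y 1 : ℂ) * pderiv 1 f x := by
  have hy : y = y 0 • EuclideanSpace.single 0 (1 : ℝ) + y 1 • EuclideanSpace.single 1 (1 : ℝ) := by
    ext i; fin_cases i <;> simp
  conv_lhs => rw [hy, map_add, map_smul, map_smul]
  simp [pderiv, SchwartzMap.lineDerivOp_apply_eq_fderiv]

/-- The derivative in the direction `unitVec θ`. -/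
def dirDeriv (θ : ℝ) (f : 𝓢(Plane, ℂ)) : 𝓢(Plane, ℂ) :=
  Real.cos θ • pderiv 0 f + Real.sin θ • pderiv 1 f

/-- Multiplication by the coordinate in the direction `unitVec θ`. -/
def dirMul (θ : ℝ) (f : 𝓢(Plane, ℂ)) : 𝓢(Plane, ℂ) :=
  Real.cos θ • coordMul 0 f + Real.sin θ • coordMul 1 f

/-- The generator of rotations. -/
def rotDeriv (f : 𝓢(Plane, ℂ)) : 𝓢(Plane, ℂ) :=
  coordMul 0 (pderiv 1 f) - coordMul 1 (pderiv 0 f)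

lemma dirDeriv_apply (θ : ℝ) (f : 𝓢(Plane, ℂ)) (x : Plane) :
    dirDeriv θ f x = fderiv ℝ f x (unitVec θ) := by
  simp [fderiv_schwartz_apply, dirDeriv, unitVec]

lemma dirMul_linePoint (θ v s : ℝ) (f : 𝓢(Plane, ℂ)) :
    dirMul θ f (linePoint θ v s) = v * f (linePoint θ v s) := by
  have h : (Real.cos θ : ℂ) * (linePoint θ v s 0 : ℝ) + Real.sin θ * (linePoint θ v s 1 : ℝ)
      = v := by
    rw [linePoint_apply_zero, linePoint_apply_one]
    norm_cast
    linear_combination v * Real.sin_sq_add_cos_sq θ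
  simp only [dirMul, add_apply, smul_apply, coordMul_apply,
    Complex.real_smul]
  linear_combination f (linePoint θ v s) * h

/-- The vector `v ω^⊥ - s ω` is the velocity of `v ω + s ω^⊥` as the angle varies, so the field `x₀
∂₁ - x₁ ∂₀`, which does not involve the angle, represents `∂_θ`. -/
lemma rotDeriv_linePoint (θ v s : ℝ) (f : 𝓢(Plane, ℂ)) :
    rotDeriv f (linePoint θ v s) =
      fderiv ℝ f (linePoint θ v s) (v • unitPerp θ - s • unitVec θ) := by
  simp only [rotDeriv, sub_apply, coordMul_apply, fderiv_schwartz_apply,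
    linePoint_apply_zero, linePoint_apply_one]
  simp [unitVec, unitPerp]
  ring

lemma hasDerivAt_unitVec (θ : ℝ) : HasDerivAt unitVec (unitPerp θ) θ := by
  have h : HasDerivAt (fun θ : ℝ => ![Real.cos θ, Real.sin θ]) ![-Real.sin θ, Real.cos θ] θ := by
    rw [hasDerivAt_pi]
    intro i
    fin_cases i
    · exact Real.hasDerivAt_cos θ
    · exact Real.hasDerivAt_sin θ
  exact ((PiLp.continuousLinearEquiv 2 ℝ fun _ : Fin 2 => ℝ).symm.hasFDerivAt).comp_hasDerivAt θ h

lemma hasDerivAt_unitPerp (θ : ℝ) : HasDerivAt unitPerp (-unitVec θ) θ := by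
  have h : HasDerivAt (fun θ : ℝ => ![-Real.sin θ, Real.cos θ])
      ![-Real.cos θ, -Real.sin θ] θ := by
    rw [hasDerivAt_pi]
    intro i
    fin_cases i
    · exact (Real.hasDerivAt_sin θ).neg
    · exact Real.hasDerivAt_cos θ
  have hu : -unitVec θ = !₂[-Real.cos θ, -Real.sin θ] := by
    ext i; fin_cases i <;> simp [unitVec]
  rw [hu]
  exact ((PiLp.continuousLinearEquiv 2 ℝ fun _ : Fin 2 => ℝ).symm.hasFDerivAt).comp_hasDerivAt θ h

lemma hasDerivAt_schwartz_linePoint (f : 𝓢(Plane, ℂ)) (θ v s : ℝ) :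
    HasDerivAt (fun v => f (linePoint θ v s)) (dirDeriv θ f (linePoint θ v s)) v := by
  have h : HasDerivAt (fun v => linePoint θ v s) ((1 : ℝ) • unitVec θ) v :=
    ((hasDerivAt_id v).smul_const (unitVec θ)).add_const (s • unitPerp θ)
  rw [one_smul] at h
  rw [dirDeriv_apply]
  exact (f.hasFDerivAt _).comp_hasDerivAt v h

lemma hasDerivAt_schwartz_linePoint_angle (f : 𝓢(Plane, ℂ)) (θ v s : ℝ) :
    HasDerivAt (fun θ => f (linePoint θ v s)) (rotDeriv f (linePoint θ v s)) θ := by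
  have h : HasDerivAt (fun θ => linePoint θ v s) (v • unitPerp θ + s • -unitVec θ) θ :=
    ((hasDerivAt_unitVec θ).const_smul v).add ((hasDerivAt_unitPerp θ).const_smul s)
  rw [smul_neg, ← sub_eq_add_neg] at h
  rw [rotDeriv_linePoint]
  exact (f.hasFDerivAt _).comp_hasDerivAt θ h

/-! ### The Radon transform and its derivatives -/

/-- A continuous seminorm that controls the decay of a Schwartz function on the plane. -/
def decayNorm : Seminorm ℝ 𝓢(Plane, ℂ) :=
  schwartzSeminormFamily ℝ Plane ℂ (0, 0) + (schwartzSeminormFamily ℝ Plane ℂ (2, 0) +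
    schwartzSeminormFamily ℝ Plane ℂ (2, 0)) + schwartzSeminormFamily ℝ Plane ℂ (4, 0)

lemma continuous_decayNorm : Continuous decayNorm := by
  have h := fun i => (schwartz_withSeminorms ℝ Plane ℂ).continuous_seminorm i
  exact ((h _).add ((h _).add (h _))).add (h _)

/-- The terms of `decayNorm` expand `(1 + |x|²)²`, which dominates `(1 + v²)(1 + s²)` because `|x|²
= v² + s²`. The product form serves twice: the factor in `s` is integrated along the line and the
factor in `v` survives. -/
lemma norm_schwartz_linePoint_le (f : 𝓢(Plane, ℂ)) (θ v s : ℝ) :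
    ‖f (linePoint θ v s)‖ ≤ decayNorm f * (1 + v ^ 2)⁻¹ * (1 + s ^ 2)⁻¹ := by
  have h := fun k => SchwartzMap.norm_pow_mul_le_seminorm ℝ f k (linePoint θ v s)
  have h0 := h 0
  have h2 := h 2
  have h4 := h 4
  have hN : decayNorm f = SchwartzMap.seminorm ℝ 0 0 f + (SchwartzMap.seminorm ℝ 2 0 f +
    SchwartzMap.seminorm ℝ 2 0 f) + SchwartzMap.seminorm ℝ 4 0 f := rfl
  rw [show (4 : ℕ) = 2 * 2 from rfl, pow_mul] at h4
  rw [norm_sq_linePoint] at h2 h4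
  rw [mul_assoc, ← mul_inv, ← div_eq_mul_inv, le_div_iff₀ (by positivity), hN]
  have hf := norm_nonneg (f (linePoint θ v s))
  nlinarith [mul_nonneg hf (sq_nonneg v), mul_nonneg hf (sq_nonneg s),
    mul_nonneg hf (mul_nonneg (sq_nonneg v) (sq_nonneg s)), mul_nonneg hf (sq_nonneg (v^2)),
    mul_nonneg hf (sq_nonneg (s^2))]

/-- The Radon transform in terms of the angle. -/
def radonAngle (f : 𝓢(Plane, ℂ)) (θ v : ℝ) : ℂ := ∫ s : ℝ, f (linePoint θ v s)

lemma radon_exp (f : 𝓢(Plane, ℂ)) (θ v : ℝ) : radon f (Circle.exp θ) v = radonAngle f θ v := by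
  simp [radon, radonAngle, linePoint, dir_exp, dirPerp_exp]

lemma integrable_schwartz_linePoint (f : 𝓢(Plane, ℂ)) (θ v : ℝ) :
    Integrable fun s => f (linePoint θ v s) :=
  (integrable_inv_one_add_sq.const_mul (decayNorm f * (1 + v ^ 2)⁻¹)).mono'
    (by fun_prop) (ae_of_all _ fun s => norm_schwartz_linePoint_le f θ v s)

lemma norm_radonAngle_le (f : 𝓢(Plane, ℂ)) (θ v : ℝ) :
    ‖radonAngle f θ v‖ ≤ Real.pi * decayNorm f * (1 + v ^ 2)⁻¹ := by
  refine (norm_integral_le_of_norm_le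
    (integrable_inv_one_add_sq.const_mul (decayNorm f * (1 + v ^ 2)⁻¹))
    (ae_of_all _ fun s => norm_schwartz_linePoint_le f θ v s)).trans_eq ?_
  rw [integral_const_mul, integral_univ_inv_one_add_sq]
  ring

lemma radonAngle_add (f g : 𝓢(Plane, ℂ)) (θ v : ℝ) :
    radonAngle (f + g) θ v = radonAngle f θ v + radonAngle g θ v :=
  integral_add (integrable_schwartz_linePoint f θ v) (integrable_schwartz_linePoint g θ v)

lemma radonAngle_smul (c : ℝ) (f : 𝓢(Plane, ℂ)) (θ v : ℝ) :
    radonAngle (c • f) θ v = c * radonAngle f θ v := by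
  rw [radonAngle, radonAngle, ← Complex.real_smul, ← integral_smul]
  rfl

lemma norm_schwartz_linePoint_le' (f : 𝓢(Plane, ℂ)) (θ v s : ℝ) :
    ‖f (linePoint θ v s)‖ ≤ decayNorm f * (1 + s ^ 2)⁻¹ := by
  refine (norm_schwartz_linePoint_le f θ v s).trans ?_
  have h1 : (1 + v ^ 2)⁻¹ ≤ 1 := inv_le_one_of_one_le₀ (by nlinarith [sq_nonneg v])
  have h2 : decayNorm f * (1 + v ^ 2)⁻¹ ≤ decayNorm f :=
    mul_le_of_le_one_right (apply_nonneg _ _) h1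
  exact mul_le_mul_of_nonneg_right h2 (by positivity)

lemma hasDerivAt_radonAngle (f : 𝓢(Plane, ℂ)) (θ v : ℝ) :
    HasDerivAt (fun v => radonAngle f θ v) (radonAngle (dirDeriv θ f) θ v) v :=
  (hasDerivAt_integral_of_dominated_loc_of_deriv_le (s := Set.univ)
    (bound := fun s => decayNorm (dirDeriv θ f) * (1 + s ^ 2)⁻¹) univ_mem
    (Eventually.of_forall fun v => (integrable_schwartz_linePoint f θ v).aestronglyMeasurable)
    (integrable_schwartz_linePoint f θ v)
    (integrable_schwartz_linePoint _ θ v).aestronglyMeasurable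
    (ae_of_all _ fun s v _ => norm_schwartz_linePoint_le' _ θ v s)
    (integrable_inv_one_add_sq.const_mul _)
    (ae_of_all _ fun s v _ => hasDerivAt_schwartz_linePoint f θ v s)).2

lemma hasDerivAt_radonAngle_angle (f : 𝓢(Plane, ℂ)) (θ v : ℝ) :
    HasDerivAt (fun θ => radonAngle f θ v) (radonAngle (rotDeriv f) θ v) θ :=
  (hasDerivAt_integral_of_dominated_loc_of_deriv_le (s := Set.univ)
    (bound := fun s => decayNorm (rotDeriv f) * (1 + s ^ 2)⁻¹) univ_mem
    (Eventually.of_forall fun θ => (integrable_schwartz_linePoint f θ v).aestronglyMeasurable)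
    (integrable_schwartz_linePoint f θ v)
    (integrable_schwartz_linePoint _ θ v).aestronglyMeasurable
    (ae_of_all _ fun s θ _ => norm_schwartz_linePoint_le' _ θ v s)
    (integrable_inv_one_add_sq.const_mul _)
    (ae_of_all _ fun s θ _ => hasDerivAt_schwartz_linePoint_angle f θ v s)).2

/-! ### Bounds uniform in the angle, and symmetries of the Radon transform -/

/-- A family of Schwartz functions is bounded if every continuous seminorm is bounded on it. -/
def BoundedFamily (F : ℝ → 𝓢(Plane, ℂ)) : Prop :=
  ∀ p : Seminorm ℝ 𝓢(Plane, ℂ), Continuous p → ∃ C, ∀ θ, p (F θ) ≤ C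

lemma BoundedFamily.const (f : 𝓢(Plane, ℂ)) : BoundedFamily fun _ => f :=
  fun p _ => ⟨p f, fun _ => le_rfl⟩

lemma BoundedFamily.add {F G : ℝ → 𝓢(Plane, ℂ)} (hF : BoundedFamily F) (hG : BoundedFamily G) :
    BoundedFamily fun θ => F θ + G θ := fun p hp => by
  obtain ⟨C, hC⟩ := hF p hp
  obtain ⟨D, hD⟩ := hG p hp
  exact ⟨C + D, fun θ => (map_add_le_add p _ _).trans (add_le_add (hC θ) (hD θ))⟩

lemma BoundedFamily.smul {F : ℝ → 𝓢(Plane, ℂ)} (hF : BoundedFamily F) {c : ℝ → ℝ} {K : ℝ}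
    (hc : ∀ θ, |c θ| ≤ K) : BoundedFamily fun θ => c θ • F θ := fun p hp => by
  obtain ⟨C, hC⟩ := hF p hp
  refine ⟨K * C, fun θ => ?_⟩
  rw [map_smul_eq_mul, Real.norm_eq_abs]
  exact mul_le_mul (hc θ) (hC θ) (apply_nonneg _ _) ((abs_nonneg _).trans (hc θ))

lemma BoundedFamily.clm {F : ℝ → 𝓢(Plane, ℂ)} (hF : BoundedFamily F)
    (T : 𝓢(Plane, ℂ) →L[ℝ] 𝓢(Plane, ℂ)) : BoundedFamily fun θ => T (F θ) :=
  fun p hp => hF (p.comp T.toLinearMap) (hp.comp T.continuous)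

/-- The operator depends on `θ` only through the bounded coefficients `cos θ` and `sin θ`, so
iterating it keeps all estimates uniform in the angle. -/
lemma BoundedFamily.dirDeriv {F : ℝ → 𝓢(Plane, ℂ)} (hF : BoundedFamily F) :
    BoundedFamily fun θ => dirDeriv θ (F θ) :=
  ((hF.clm _).smul Real.abs_cos_le_one).add ((hF.clm _).smul Real.abs_sin_le_one)

lemma BoundedFamily.dirMul {F : ℝ → 𝓢(Plane, ℂ)} (hF : BoundedFamily F) :
    BoundedFamily fun θ => dirMul θ (F θ) :=
  ((hF.clm _).smul Real.abs_cos_le_one).add ((hF.clm _).smul Real.abs_sin_le_one)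

/-- A function of two real variables with bounded partial derivatives is continuous. -/
lemma continuous_of_bounded_partials {F F₁ F₂ : ℝ → ℝ → ℂ} {C₁ C₂ : ℝ}
    (h₁ : ∀ a b, HasDerivAt (fun a => F a b) (F₁ a b) a)
    (h₂ : ∀ a b, HasDerivAt (fun b => F a b) (F₂ a b) b)
    (b₁ : ∀ a b, ‖F₁ a b‖ ≤ C₁) (b₂ : ∀ a b, ‖F₂ a b‖ ≤ C₂) :
    Continuous fun p : ℝ × ℝ => F p.1 p.2 := by
  rw [continuous_iff_continuousAt]
  rintro ⟨a, b⟩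
  refine tendsto_iff_norm_sub_tendsto_zero.2 ?_
  refine squeeze_zero (g := fun p : ℝ × ℝ => C₁ * ‖p.1 - a‖ + C₂ * ‖p.2 - b‖)
    (fun _ => norm_nonneg _) (fun p => ?_) ?_
  · have e₁ := convex_univ.norm_image_sub_le_of_norm_hasDerivWithin_le
      (fun a _ => (h₁ a p.2).hasDerivWithinAt) (fun a _ => b₁ a p.2)
      (Set.mem_univ a) (Set.mem_univ p.1)
    have e₂ := convex_univ.norm_image_sub_le_of_norm_hasDerivWithin_le
      (fun b _ => (h₂ a b).hasDerivWithinAt) (fun b _ => b₂ a b)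
      (Set.mem_univ b) (Set.mem_univ p.2)
    have e := norm_add_le (F p.1 p.2 - F a p.2) (F a p.2 - F a b)
    rw [sub_add_sub_cancel] at e
    linarith
  · have : Continuous fun p : ℝ × ℝ => C₁ * ‖p.1 - a‖ + C₂ * ‖p.2 - b‖ := by fun_prop
    simpa using this.tendsto (a, b)

lemma norm_radonAngle_le_const (f : 𝓢(Plane, ℂ)) (θ v : ℝ) :
    ‖radonAngle f θ v‖ ≤ Real.pi * decayNorm f := by
  refine (norm_radonAngle_le f θ v).trans (mul_le_of_le_one_right ?_ ?_)
  · have := apply_nonneg decayNorm f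
    positivity
  · exact inv_le_one_of_one_le₀ (by nlinarith [sq_nonneg v])

lemma BoundedFamily.exists_decayNorm {F : ℝ → 𝓢(Plane, ℂ)} (hF : BoundedFamily F) :
    ∃ C, 0 ≤ C ∧ ∀ θ, decayNorm (F θ) ≤ C := by
  obtain ⟨C, hC⟩ := hF _ continuous_decayNorm
  exact ⟨C, (apply_nonneg _ _).trans (hC 0), hC⟩

lemma continuous_radonAngle (f : 𝓢(Plane, ℂ)) :
    Continuous fun p : ℝ × ℝ => radonAngle f p.1 p.2 := by
  obtain ⟨C, -, hC⟩ := (BoundedFamily.const f).dirDeriv.exists_decayNorm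
  exact continuous_of_bounded_partials (hasDerivAt_radonAngle_angle f) (hasDerivAt_radonAngle f)
    (norm_radonAngle_le_const _) (fun θ v => (norm_radonAngle_le_const _ θ v).trans
      (mul_le_mul_of_nonneg_left (hC θ) Real.pi_nonneg))

lemma unitVec_add_pi (θ : ℝ) : unitVec (θ + Real.pi) = -unitVec θ := by
  ext i; fin_cases i <;> simp [unitVec]

lemma unitPerp_add_pi (θ : ℝ) : unitPerp (θ + Real.pi) = -unitPerp θ := by
  ext i; fin_cases i <;> simp [unitPerp]

lemma radonAngle_add_pi (f : 𝓢(Plane, ℂ)) (θ v : ℝ) :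
    radonAngle f (θ + Real.pi) (-v) = radonAngle f θ v := by
  rw [radonAngle, ← integral_neg_eq_self]
  simp [radonAngle, linePoint, unitVec_add_pi, unitPerp_add_pi]

lemma radonAngle_dirMul (f : 𝓢(Plane, ℂ)) (θ v : ℝ) :
    radonAngle (dirMul θ f) θ v = v * radonAngle f θ v := by
  simp only [radonAngle, dirMul_linePoint]
  exact integral_const_mul _ _

/-! ### The principal value as an absolutely convergent integral -/

/-- The odd part of `φ` about `v`, divided by the distance to `v`. -/
def oddQuotient (φ : ℝ → ℂ) (v s : ℝ) : ℂ := (φ (v - s) - φ (v + s)) / (s : ℂ)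

/-- The symmetrized form of the principal value integral of `φ ν / (v - ν)`. -/
def symHilbert (φ : ℝ → ℂ) (v : ℝ) : ℂ := (1 / 2 : ℂ) * ∫ s : ℝ, oddQuotient φ v s

/-- Quadratic decay together with a Lipschitz bound. -/
structure HilbertBound (φ : ℝ → ℂ) (A B : ℝ) : Prop where
  continuous : Continuous φ
  decay : ∀ w, ‖φ w‖ ≤ A * (1 + w ^ 2)⁻¹
  lipschitz : ∀ x y, ‖φ y - φ x‖ ≤ B * |y - x|

namespace HilbertBound

variable {φ : ℝ → ℂ} {A B : ℝ}

lemma nonneg_left (h : HilbertBound φ A B) : 0 ≤ A := by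
  simpa using (norm_nonneg _).trans (h.decay 0)

lemma nonneg_right (h : HilbertBound φ A B) : 0 ≤ B := by
  simpa using (norm_nonneg _).trans (h.lipschitz 0 1)

lemma integrable (h : HilbertBound φ A B) : Integrable φ :=
  (integrable_inv_one_add_sq.const_mul A).mono' h.continuous.aestronglyMeasurable
    (ae_of_all _ h.decay)

/-- For `|s| ≤ 1` the Lipschitz bound removes the singularity, and for `|s| ≥ 1` the quadratic decay
suffices. The integral of this majorant does not depend on `v`, which yields the uniform bound
`norm_symHilbert_le`. -/
lemma norm_oddQuotient_le (h : HilbertBound φ A B) (v s : ℝ) :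
    ‖oddQuotient φ v s‖ ≤
      4 * B * (1 + s ^ 2)⁻¹ + (A * (1 + (v - s) ^ 2)⁻¹ + A * (1 + (v + s) ^ 2)⁻¹) := by
  have hA := h.nonneg_left
  have hB := h.nonneg_right
  rcases le_total |s| 1 with hs | hs
  · have h1 : ‖oddQuotient φ v s‖ ≤ 2 * B := by
      rw [oddQuotient, norm_div, Complex.norm_real, Real.norm_eq_abs]
      refine div_le_of_le_mul₀ (abs_nonneg _) (by positivity) ?_
      have := h.lipschitz (v + s) (v - s)
      rwa [show v - s - (v + s) = (-2) * s by ring, abs_mul, abs_neg, abs_two, ← mul_assoc,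
        mul_comm B] at this
    have h2 : 2 * B ≤ 4 * B * (1 + s ^ 2)⁻¹ := by
      have : s ^ 2 ≤ 1 := (sq_le_one_iff_abs_le_one s).2 hs
      rw [← div_eq_mul_inv, le_div_iff₀ (by positivity)]
      nlinarith
    have h3 : 0 ≤ A * (1 + (v - s) ^ 2)⁻¹ + A * (1 + (v + s) ^ 2)⁻¹ := by positivity
    linarith
  · have h1 : ‖oddQuotient φ v s‖ ≤ ‖φ (v - s)‖ + ‖φ (v + s)‖ := by
      rw [oddQuotient, norm_div, Complex.norm_real, Real.norm_eq_abs]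
      exact (div_le_self (norm_nonneg _) hs).trans (norm_sub_le _ _)
    have h3 : 0 ≤ 4 * B * (1 + s ^ 2)⁻¹ := by positivity
    linarith [h.decay (v - s), h.decay (v + s)]

/-- The translated majorants are replaced by one centred at the origin, using `s² ≤ 2 (v ± s)² + 2
v²`. A single dominating function for all `|v| ≤ V` is what differentiation under the integral
needs. -/
lemma norm_oddQuotient_le_of_abs_le (h : HilbertBound φ A B) {v V : ℝ} (hv : |v| ≤ V) (s : ℝ) :
    ‖oddQuotient φ v s‖ ≤ (4 * B + 4 * A * (1 + V ^ 2)) * (1 + s ^ 2)⁻¹ := by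
  have hA := h.nonneg_left
  have key : ∀ t : ℝ, t ^ 2 = s ^ 2 → (1 + (v + t) ^ 2)⁻¹ ≤ 2 * (1 + V ^ 2) * (1 + s ^ 2)⁻¹ := by
    intro t ht
    have hV : v ^ 2 ≤ V ^ 2 := sq_le_sq.2 (hv.trans (le_abs_self V))
    rw [← div_eq_mul_inv, inv_eq_one_div, div_le_div_iff₀ (by positivity) (by positivity), ← ht]
    nlinarith [sq_nonneg (v + t + v), mul_nonneg (sq_nonneg V) (sq_nonneg (v + t)),
      sq_nonneg (v + t)]
  have h1 := mul_le_mul_of_nonneg_left (key (-s) (neg_sq s)) hA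
  have h2 := mul_le_mul_of_nonneg_left (key s rfl) hA
  rw [← sub_eq_add_neg] at h1
  refine (h.norm_oddQuotient_le v s).trans ?_
  linarith

lemma aestronglyMeasurable_oddQuotient (h : HilbertBound φ A B) (v : ℝ) :
    AEStronglyMeasurable (oddQuotient φ v) := by
  have := h.continuous.measurable
  unfold oddQuotient
  exact Measurable.aestronglyMeasurable (by fun_prop)

lemma integrable_oddQuotient (h : HilbertBound φ A B) (v : ℝ) : Integrable (oddQuotient φ v) :=
  (integrable_inv_one_add_sq.const_mul _).mono' (h.aestronglyMeasurable_oddQuotient v)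
    (ae_of_all _ (h.norm_oddQuotient_le_of_abs_le le_rfl))

lemma norm_symHilbert_le (h : HilbertBound φ A B) (v : ℝ) :
    ‖symHilbert φ v‖ ≤ Real.pi * (2 * B + A) := by
  have i1 : Integrable fun s : ℝ => (1 + (v - s) ^ 2)⁻¹ :=
    integrable_inv_one_add_sq.comp_sub_left v
  have i2 : Integrable fun s : ℝ => (1 + (v + s) ^ 2)⁻¹ :=
    integrable_inv_one_add_sq.comp_add_left v
  have e1 : ∫ s : ℝ, (1 + (v - s) ^ 2)⁻¹ = Real.pi := by
    rw [integral_sub_left_eq_self (fun s : ℝ => (1 + s ^ 2)⁻¹), integral_univ_inv_one_add_sq]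
  have e2 : ∫ s : ℝ, (1 + (v + s) ^ 2)⁻¹ = Real.pi := by
    rw [integral_add_left_eq_self (fun s : ℝ => (1 + s ^ 2)⁻¹), integral_univ_inv_one_add_sq]
  have key : ‖∫ s, oddQuotient φ v s‖ ≤ ∫ s : ℝ, (4 * B * (1 + s ^ 2)⁻¹ +
      (A * (1 + (v - s) ^ 2)⁻¹ + A * (1 + (v + s) ^ 2)⁻¹)) :=
    norm_integral_le_of_norm_le ((integrable_inv_one_add_sq.const_mul (4 * B)).add
    ((i1.const_mul A).add (i2.const_mul A))) (ae_of_all _ (h.norm_oddQuotient_le v))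
  have e : ∫ s : ℝ, (4 * B * (1 + s ^ 2)⁻¹ +
      (A * (1 + (v - s) ^ 2)⁻¹ + A * (1 + (v + s) ^ 2)⁻¹)) = (∫ s : ℝ, 4 * B * (1 + s ^ 2)⁻¹) +
      ∫ s : ℝ, (A * (1 + (v - s) ^ 2)⁻¹ + A * (1 + (v + s) ^ 2)⁻¹) :=
    integral_add (integrable_inv_one_add_sq.const_mul _) ((i1.const_mul A).add (i2.const_mul A))
  rw [e, integral_add (i1.const_mul A) (i2.const_mul A), integral_const_mul, integral_const_mul,
    integral_const_mul, e1, e2, integral_univ_inv_one_add_sq] at key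
  rw [symHilbert, norm_mul]
  have : ‖(1 / 2 : ℂ)‖ = 1 / 2 := by norm_num
  rw [this]
  linarith

lemma integrableOn_div (h : HilbertBound φ A B) (v : ℝ) {ε : ℝ} (hε : 0 < ε) :
    IntegrableOn (fun ν : ℝ => φ ν / ((v : ℂ) - ν)) {ν : ℝ | ε < |ν - v|} := by
  have hm : MeasurableSet {ν : ℝ | ε < |ν - v|} :=
    measurableSet_lt measurable_const (by fun_prop)
  have := h.continuous.measurable
  refine Integrable.mono' (g := fun ν => ε⁻¹ * ‖φ ν‖) (h.integrable.norm.const_mul _).integrableOn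
    (Measurable.aestronglyMeasurable (by fun_prop)) ?_
  refine (ae_restrict_iff' hm).2 (ae_of_all _ fun ν hν => ?_)
  have hν : ε < |ν - v| := hν
  rw [norm_div, ← Complex.ofReal_sub, Complex.norm_real, Real.norm_eq_abs, abs_sub_comm,
    div_eq_inv_mul]
  exact mul_le_mul_of_nonneg_right (inv_anti₀ hε hν.le) (norm_nonneg _)

/-- The truncation is symmetric about `v`, so the substitutions `ν = v - s` and `ν = v + s` give the
same integral; their average contains the odd quotient. -/
lemma truncatedHilbert_eq (h : HilbertBound φ A B) (v : ℝ) {ε : ℝ} (hε : 0 < ε) :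
    truncatedHilbert φ v ε =
      (1 / 2 : ℂ) * ∫ s : ℝ, Set.indicator {s : ℝ | ε < |s|} (oddQuotient φ v) s := by
  have hm : MeasurableSet {ν : ℝ | ε < |ν - v|} :=
    measurableSet_lt measurable_const (by fun_prop)
  set F : ℝ → ℂ := Set.indicator {ν : ℝ | ε < |ν - v|} fun ν => φ ν / ((v : ℂ) - ν) with hF
  have hi : Integrable F := (integrable_indicator_iff hm).2 (h.integrableOn_div v hε)
  have e1 : ∫ s, F (v - s) = truncatedHilbert φ v ε := by
    rw [integral_sub_left_eq_self F, hF, integral_indicator hm, truncatedHilbert]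
  have e2 : ∫ s, F (v + s) = truncatedHilbert φ v ε := by
    rw [integral_add_left_eq_self F, hF, integral_indicator hm, truncatedHilbert]
  have e3 : ∫ s, (F (v - s) + F (v + s)) = truncatedHilbert φ v ε + truncatedHilbert φ v ε := by
    rw [integral_add (hi.comp_sub_left v) (hi.comp_add_left v), e1, e2]
  have e4 : (fun s => F (v - s) + F (v + s)) =
      Set.indicator {s : ℝ | ε < |s|} (oddQuotient φ v) := by
    ext s
    by_cases hs : ε < |s|
    · simp [hF, Set.indicator, hs, oddQuotient, div_neg, sub_eq_add_neg, add_div, neg_div]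
    · simp [hF, Set.indicator, hs]
  rw [← e4, e3]
  ring

lemma hasPrincipalValue (h : HilbertBound φ A B) (v : ℝ) :
    HasPrincipalValue φ v (symHilbert φ v) := by
  refine ⟨fun ε hε => h.integrableOn_div v hε, ?_⟩
  have key : Tendsto (fun ε : ℝ => (1 / 2 : ℂ) * ∫ s : ℝ,
      Set.indicator {s : ℝ | ε < |s|} (oddQuotient φ v) s) (𝓝[>] 0) (𝓝 (symHilbert φ v)) := by
    refine Tendsto.const_mul _ (tendsto_integral_filter_of_dominated_convergence
      (fun s => ‖oddQuotient φ v s‖) (Eventually.of_forall fun ε => ?_)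
      (Eventually.of_forall fun ε => ae_of_all _ fun s => norm_indicator_le_norm_self _ _)
      (h.integrable_oddQuotient v).norm (ae_of_all _ fun s => ?_))
    · exact (h.aestronglyMeasurable_oddQuotient v).indicator
        (measurableSet_lt measurable_const (by fun_prop))
    · refine tendsto_const_nhds.congr' ?_
      rcases eq_or_ne s 0 with rfl | hs
      -- Division by zero makes the quotient vanish at `s = 0`, so the pointwise limit holds there
      -- too.
      · exact Eventually.of_forall fun ε => by simp [Set.indicator, oddQuotient]
      · filter_upwards [mem_nhdsWithin_of_mem_nhds (Iio_mem_nhds (abs_pos.2 hs))] with ε hε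
        have : ε < |s| := hε
        simp [Set.indicator, this]
  refine key.congr' ?_
  filter_upwards [self_mem_nhdsWithin] with ε hε
  exact (h.truncatedHilbert_eq v hε).symm

end HilbertBound

/-! ### Differentiability of the Hilbert transform of the Radon transform -/

/-- The symmetrized Hilbert transform of the Radon transform. -/
def hilbertRadon (f : 𝓢(Plane, ℂ)) (θ v : ℝ) : ℂ := symHilbert (radonAngle f θ) v

lemma hilbertBound_radonAngle (f : 𝓢(Plane, ℂ)) (θ : ℝ) :
    HilbertBound (radonAngle f θ) (Real.pi * decayNorm f)
      (Real.pi * decayNorm (dirDeriv θ f)) where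
  continuous := continuous_iff_continuousAt.2 fun v => (hasDerivAt_radonAngle f θ v).continuousAt
  decay := norm_radonAngle_le f θ
  lipschitz _ _ := convex_univ.norm_image_sub_le_of_norm_hasDerivWithin_le
      (fun v _ => (hasDerivAt_radonAngle f θ v).hasDerivWithinAt)
      (fun v _ => norm_radonAngle_le_const _ θ v) (Set.mem_univ _) (Set.mem_univ _)

lemma HilbertBound.mono {φ : ℝ → ℂ} {A A' B B' : ℝ} (h : HilbertBound φ A B) (hA : A ≤ A')
    (hB : B ≤ B') : HilbertBound φ A' B' where
  continuous := h.continuous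
  decay w := (h.decay w).trans (mul_le_mul_of_nonneg_right hA (by positivity))
  lipschitz x y := (h.lipschitz x y).trans (mul_le_mul_of_nonneg_right hB (abs_nonneg _))

lemma BoundedFamily.hilbertBound {F : ℝ → 𝓢(Plane, ℂ)} (hF : BoundedFamily F) :
    ∃ A B, ∀ θ, HilbertBound (radonAngle (F θ) θ) A B := by
  obtain ⟨A, -, hA⟩ := hF.exists_decayNorm
  obtain ⟨B, -, hB⟩ := hF.dirDeriv.exists_decayNorm
  exact ⟨Real.pi * A, Real.pi * B, fun θ => (hilbertBound_radonAngle (F θ) θ).mono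
    (mul_le_mul_of_nonneg_left (hA θ) Real.pi_nonneg)
    (mul_le_mul_of_nonneg_left (hB θ) Real.pi_nonneg)⟩

lemma BoundedFamily.norm_hilbertRadon_le {F : ℝ → 𝓢(Plane, ℂ)} (hF : BoundedFamily F) :
    ∃ C, ∀ θ v, ‖hilbertRadon (F θ) θ v‖ ≤ C := by
  obtain ⟨A, B, h⟩ := hF.hilbertBound
  exact ⟨_, fun θ v => (h θ).norm_symHilbert_le v⟩

lemma hilbertRadon_add (f g : 𝓢(Plane, ℂ)) (θ v : ℝ) :
    hilbertRadon (f + g) θ v = hilbertRadon f θ v + hilbertRadon g θ v := by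
  rw [hilbertRadon, hilbertRadon, hilbertRadon, symHilbert, symHilbert, symHilbert, ← mul_add,
    ← integral_add ((hilbertBound_radonAngle f θ).integrable_oddQuotient v)
      ((hilbertBound_radonAngle g θ).integrable_oddQuotient v)]
  refine congrArg (fun z : ℂ => (1 / 2 : ℂ) * z) (integral_congr_ae (ae_of_all _ fun s => ?_))
  simp only [oddQuotient, radonAngle_add]
  ring

lemma hilbertRadon_smul (c : ℝ) (f : 𝓢(Plane, ℂ)) (θ v : ℝ) :
    hilbertRadon (c • f) θ v = c * hilbertRadon f θ v := by
  rw [hilbertRadon, hilbertRadon, symHilbert, symHilbert, mul_left_comm, ← integral_const_mul (c : ℂ)]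
  refine congrArg (fun z : ℂ => (1 / 2 : ℂ) * z) (integral_congr_ae (ae_of_all _ fun s => ?_))
  simp only [oddQuotient, radonAngle_smul]
  ring

lemma hasDerivAt_hilbertRadon (f : 𝓢(Plane, ℂ)) (θ v : ℝ) :
    HasDerivAt (fun v => hilbertRadon f θ v) (hilbertRadon (dirDeriv θ f) θ v) v := by
  have hb := hilbertBound_radonAngle (dirDeriv θ f) θ
  refine HasDerivAt.const_mul _ (hasDerivAt_integral_of_dominated_loc_of_deriv_le
    (Metric.ball_mem_nhds v one_pos)
    (Eventually.of_forall fun v =>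
      (hilbertBound_radonAngle f θ).aestronglyMeasurable_oddQuotient v)
    ((hilbertBound_radonAngle f θ).integrable_oddQuotient v)
    (hb.aestronglyMeasurable_oddQuotient v)
    (ae_of_all _ fun s w hw => hb.norm_oddQuotient_le_of_abs_le (V := |v| + 1) ?_ s)
    (integrable_inv_one_add_sq.const_mul _)
    (ae_of_all _ fun s w _ => ?_)).2
  · have h1 : |w - v| < 1 := by simpa [Real.dist_eq] using hw
    linarith [abs_sub_abs_le_abs_sub w v]
  · have h1 := (hasDerivAt_radonAngle f θ (w - s)).comp_sub_const w s
    have h2 := (hasDerivAt_radonAngle f θ (w + s)).comp_add_const w s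
    exact (h1.sub h2).div_const (s : ℂ)

lemma hasDerivAt_hilbertRadon_angle (f : 𝓢(Plane, ℂ)) (θ v : ℝ) :
    HasDerivAt (fun θ => hilbertRadon f θ v) (hilbertRadon (rotDeriv f) θ v) θ := by
  obtain ⟨A, B, hb⟩ := (BoundedFamily.const (rotDeriv f)).hilbertBound
  refine HasDerivAt.const_mul _ (hasDerivAt_integral_of_dominated_loc_of_deriv_le
    (s := Set.univ) univ_mem
    (Eventually.of_forall fun θ =>
      (hilbertBound_radonAngle f θ).aestronglyMeasurable_oddQuotient v)
    ((hilbertBound_radonAngle f θ).integrable_oddQuotient v)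
    ((hb θ).aestronglyMeasurable_oddQuotient v)
    (ae_of_all _ fun s η _ => (hb η).norm_oddQuotient_le_of_abs_le le_rfl s)
    (integrable_inv_one_add_sq.const_mul _)
    (ae_of_all _ fun s η _ => ?_)).2
  exact ((hasDerivAt_radonAngle_angle f η (v - s)).sub
    (hasDerivAt_radonAngle_angle f η (v + s))).div_const (s : ℂ)

lemma continuous_hilbertRadon (f : 𝓢(Plane, ℂ)) :
    Continuous fun p : ℝ × ℝ => hilbertRadon f p.1 p.2 := by
  obtain ⟨C₁, h₁⟩ := (BoundedFamily.const (rotDeriv f)).norm_hilbertRadon_le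
  obtain ⟨C₂, h₂⟩ := (BoundedFamily.const f).dirDeriv.norm_hilbertRadon_le
  exact continuous_of_bounded_partials (hasDerivAt_hilbertRadon_angle f)
    (hasDerivAt_hilbertRadon f) h₁ h₂

lemma hilbertRadon_dirDeriv (f : 𝓢(Plane, ℂ)) (θ v : ℝ) :
    hilbertRadon (dirDeriv θ f) θ v = Real.cos θ * hilbertRadon (pderiv 0 f) θ v +
      Real.sin θ * hilbertRadon (pderiv 1 f) θ v := by
  rw [dirDeriv, hilbertRadon_add, hilbertRadon_smul, hilbertRadon_smul]

/-- Both partial derivatives are combinations, with coefficients smooth in the angle, of the same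
transform applied to other fixed Schwartz functions. Hence the induction on `n` runs over all `f` at
once. -/
lemma contDiff_nat_hilbertRadon (n : ℕ) (f : 𝓢(Plane, ℂ)) :
    ContDiff ℝ n fun p : ℝ × ℝ => hilbertRadon f p.1 p.2 := by
  induction n generalizing f with
  | zero => exact contDiff_zero.2 (continuous_hilbertRadon f)
  | succ n ih =>
    have hd : ∀ p : ℝ × ℝ, HasFDerivAt (fun p : ℝ × ℝ => hilbertRadon f p.1 p.2)
        ((ContinuousLinearMap.toSpanSingleton ℝ (hilbertRadon (rotDeriv f) p.1 p.2)).coprod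
          (ContinuousLinearMap.toSpanSingleton ℝ (hilbertRadon (dirDeriv p.1 f) p.1 p.2))) p := by
      intro p
      refine (hasStrictFDerivAt_uncurry_coprod (f := hilbertRadon f)
        (f₁ := fun θ v => ContinuousLinearMap.toSpanSingleton ℝ (hilbertRadon (rotDeriv f) θ v))
        (f₂ := fun θ v => ContinuousLinearMap.toSpanSingleton ℝ (hilbertRadon (dirDeriv θ f) θ v))
        (Eventually.of_forall fun q => hasDerivAt_hilbertRadon_angle f q.1 q.2)
        (Eventually.of_forall fun q => hasDerivAt_hilbertRadon f q.1 q.2)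
        (Continuous.continuousAt ?_) (Continuous.continuousAt ?_)).hasFDerivAt
      · exact (ContinuousLinearMap.toSpanSingletonCLE (𝕜 := ℝ) (E := ℂ)).continuous.comp
          (continuous_hilbertRadon (rotDeriv f))
      · refine (ContinuousLinearMap.toSpanSingletonCLE (𝕜 := ℝ) (E := ℂ)).continuous.comp
          (g := fun z => ContinuousLinearMap.toSpanSingleton ℝ z) ?_
        change Continuous fun q : ℝ × ℝ => hilbertRadon (dirDeriv q.1 f) q.1 q.2
        simp only [hilbertRadon_dirDeriv]
        have h0 := continuous_hilbertRadon (pderiv 0 f)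
        have h1 := continuous_hilbertRadon (pderiv 1 f)
        fun_prop
    rw [Nat.cast_succ, contDiff_succ_iff_hasFDerivAt]
    refine ⟨_, ?_, hd⟩
    have e : ∀ a b : ℂ, (ContinuousLinearMap.toSpanSingleton ℝ a).coprod
        (ContinuousLinearMap.toSpanSingleton ℝ b) =
        (ContinuousLinearMap.fst ℝ ℝ ℝ).smulRight a +
          (ContinuousLinearMap.snd ℝ ℝ ℝ).smulRight b := by
      intro a b; ext <;> simp
    simp only [e, hilbertRadon_dirDeriv]
    have h := ih (rotDeriv f)
    have h0 := ih (pderiv 0 f)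
    have h1 := ih (pderiv 1 f)
    have hc : ContDiff ℝ n fun p : ℝ × ℝ => (Real.cos p.1 : ℂ) :=
      Complex.ofRealCLM.contDiff.comp (Real.contDiff_cos.comp contDiff_fst)
    have hs : ContDiff ℝ n fun p : ℝ × ℝ => (Real.sin p.1 : ℂ) :=
      Complex.ofRealCLM.contDiff.comp (Real.contDiff_sin.comp contDiff_fst)
    exact (contDiff_const.smulRight h).add
      (contDiff_const.smulRight ((hc.mul h0).add (hs.mul h1)))

lemma contDiff_hilbertRadon (f : 𝓢(Plane, ℂ)) :
    ContDiff ℝ ∞ fun p : ℝ × ℝ => hilbertRadon f p.1 p.2 :=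
  contDiff_infty.2 fun n => contDiff_nat_hilbertRadon n f

/-! ### Weighted bounds in `v` -/

lemma mul_hilbertRadon (f : 𝓢(Plane, ℂ)) (θ v : ℝ) :
    v * hilbertRadon f θ v = hilbertRadon (dirMul θ f) θ v + ∫ w, radonAngle f θ w := by
  have hb := hilbertBound_radonAngle f θ
  have hm := hilbertBound_radonAngle (dirMul θ f) θ
  have i1 := hb.integrable.comp_sub_left v
  have i2 := hb.integrable.comp_add_left v
  -- Write `v = (v - s) + s` in the first term of the odd quotient and `v = (v + s) - s` in the
  -- second: the part `± s` cancels the denominator. The two terms left over integrate to twice `∫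
  -- f̂`, and the factor `1 / 2` halves this.
  have e : ∀ᵐ s : ℝ, (v : ℂ) * oddQuotient (radonAngle f θ) v s =
      oddQuotient (radonAngle (dirMul θ f) θ) v s +
        (radonAngle f θ (v - s) + radonAngle f θ (v + s)) := by
    filter_upwards [Measure.ae_ne volume (0 : ℝ)] with s hs
    have hs : (s : ℂ) ≠ 0 := Complex.ofReal_ne_zero.2 hs
    simp only [oddQuotient, radonAngle_dirMul]
    push_cast
    field_simp
    ring
  have e' : ∫ s, (oddQuotient (radonAngle (dirMul θ f) θ) v s +
        (radonAngle f θ (v - s) + radonAngle f θ (v + s))) =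
      (∫ s, oddQuotient (radonAngle (dirMul θ f) θ) v s) +
        ∫ s, (radonAngle f θ (v - s) + radonAngle f θ (v + s)) :=
    integral_add (hm.integrable_oddQuotient v) (i1.add i2)
  rw [hilbertRadon, hilbertRadon, symHilbert, symHilbert, mul_left_comm,
    ← integral_const_mul (v : ℂ), integral_congr_ae e, e', integral_add i1 i2,
    integral_sub_left_eq_self (radonAngle f θ), integral_add_left_eq_self (radonAngle f θ)]
  ring

/-- The integrand is a `v`-derivative of a decaying function. This removes the constant term of
`mul_hilbertRadon` in the induction on the order of the weight. -/
lemma integral_radonAngle_dirDeriv (f : 𝓢(Plane, ℂ)) (θ : ℝ) :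
    ∫ w, radonAngle (dirDeriv θ f) θ w = 0 :=
  integral_eq_zero_of_hasDerivAt_of_integrable (hasDerivAt_radonAngle f θ)
    (hilbertBound_radonAngle _ θ).integrable (hilbertBound_radonAngle _ θ).integrable

lemma contDiff_hilbertRadon_snd (f : 𝓢(Plane, ℂ)) (θ : ℝ) : ContDiff ℝ ∞ (hilbertRadon f θ) :=
  ContDiff.comp (g := fun p : ℝ × ℝ => hilbertRadon f p.1 p.2) (f := fun v => (θ, v))
    (contDiff_hilbertRadon f) (contDiff_const.prodMk contDiff_id)

lemma exists_iteratedDeriv_hilbertRadon_eq (f : 𝓢(Plane, ℂ)) (l : ℕ) :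
    ∃ F : ℝ → 𝓢(Plane, ℂ), BoundedFamily F ∧
      ∀ θ v, iteratedDeriv l (hilbertRadon f θ) v = hilbertRadon (F θ) θ v := by
  induction l with
  | zero => exact ⟨_, BoundedFamily.const f, fun θ v => by simp⟩
  | succ l ih =>
    obtain ⟨F, hF, h⟩ := ih
    refine ⟨_, hF.dirDeriv, fun θ v => ?_⟩
    rw [iteratedDeriv_succ, funext (h θ)]
    exact (hasDerivAt_hilbertRadon (F θ) θ v).deriv

lemma exists_pow_mul_iteratedDeriv_hilbertRadon_eq (f : 𝓢(Plane, ℂ)) (l : ℕ) :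
    ∃ F : ℝ → 𝓢(Plane, ℂ), BoundedFamily F ∧
      ∀ θ v : ℝ, (v : ℂ) ^ l * iteratedDeriv l (hilbertRadon f θ) v =
        hilbertRadon (F θ) θ v := by
  induction l with
  | zero => exact ⟨_, BoundedFamily.const f, fun θ v => by simp⟩
  | succ l ih =>
    obtain ⟨F, hF, h⟩ := ih
    -- The witness comes from `v ^ (l + 1) ∂ ^ (l + 1) = v ∂ (v ^ l ∂ ^ l) - l v ^ l ∂ ^ l`.
    refine ⟨fun θ => dirMul θ (dirDeriv θ (F θ)) + (-(l : ℝ)) • F θ,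
      hF.dirDeriv.dirMul.add (hF.smul (K := |-(l : ℝ)|) fun _ => le_rfl), fun θ v => ?_⟩
    have h1 : HasDerivAt (fun v : ℝ => (v : ℂ) ^ l * iteratedDeriv l (hilbertRadon f θ) v)
        ((l : ℂ) * (v : ℂ) ^ (l - 1) * iteratedDeriv l (hilbertRadon f θ) v +
          (v : ℂ) ^ l * iteratedDeriv (l + 1) (hilbertRadon f θ) v) v := by
      refine HasDerivAt.mul ?_ ?_
      · have h0 := (Complex.ofRealCLM.hasDerivAt (x := v)).pow l
        rw [Complex.ofRealCLM_apply, Complex.ofRealCLM_apply, Complex.ofReal_one, mul_one] at h0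
        exact h0
      · rw [iteratedDeriv_succ]
        refine (((contDiff_hilbertRadon_snd f θ).differentiable_iteratedDeriv l ?_) v).hasDerivAt
        exact mod_cast WithTop.coe_lt_coe.2 (ENat.natCast_lt_top l)
    rw [funext (h θ)] at h1
    have h2 := h1.unique (hasDerivAt_hilbertRadon (F θ) θ v)
    have h3 := mul_hilbertRadon (dirDeriv θ (F θ)) θ v
    rw [integral_radonAngle_dirDeriv, add_zero] at h3
    -- The truncated subtraction is harmless: for `l = 0` the factor `l` kills both sides.
    have h4 : (v : ℂ) * ((l : ℂ) * (v : ℂ) ^ (l - 1)) = l * (v : ℂ) ^ l := by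
      cases l with
      | zero => simp
      | succ l => simp; ring
    rw [hilbertRadon_add, hilbertRadon_smul, ← h3, ← h2, ← h θ v]
    push_cast
    linear_combination iteratedDeriv l (hilbertRadon f θ) v * (-h4)

lemma exists_weighted_bound_hilbertRadon (f : 𝓢(Plane, ℂ)) {k l : ℕ} (hk : k ≤ l + 1) :
    ∃ C, ∀ θ v : ℝ, (1 + |v| ^ k) * ‖iteratedDeriv l (hilbertRadon f θ) v‖ ≤ C := by
  obtain ⟨F, hF, h⟩ := exists_pow_mul_iteratedDeriv_hilbertRadon_eq f l
  obtain ⟨G, hG, h'⟩ := exists_iteratedDeriv_hilbertRadon_eq f l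
  obtain ⟨C₁, hC₁⟩ := hG.norm_hilbertRadon_le
  obtain ⟨C₂, hC₂⟩ := hF.dirMul.norm_hilbertRadon_le
  obtain ⟨A, B, hAB⟩ := hF.hilbertBound
  have hI : ∀ θ, ‖∫ w, radonAngle (F θ) θ w‖ ≤ A * Real.pi := fun θ => by
    refine (norm_integral_le_of_norm_le (integrable_inv_one_add_sq.const_mul A)
      (ae_of_all _ (hAB θ).decay)).trans_eq ?_
    rw [integral_const_mul, integral_univ_inv_one_add_sq]
  -- The weight is at most `2 + |v| ^ (l + 1)`. The constant part uses the bound on the derivative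
  -- itself, and the top power uses `mul_hilbertRadon` once more, now with its constant term
  -- retained.
  refine ⟨2 * C₁ + (C₂ + A * Real.pi), fun θ v => ?_⟩
  have e1 : ‖iteratedDeriv l (hilbertRadon f θ) v‖ ≤ C₁ := by
    rw [h' θ v]; exact hC₁ θ v
  have e2 : |v| ^ (l + 1) * ‖iteratedDeriv l (hilbertRadon f θ) v‖ ≤ C₂ + A * Real.pi := by
    have : ‖(v : ℂ) * hilbertRadon (F θ) θ v‖ =
        |v| ^ (l + 1) * ‖iteratedDeriv l (hilbertRadon f θ) v‖ := by
      rw [← h θ v]; simp; ring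
    rw [← this, mul_hilbertRadon]
    exact (norm_add_le _ _).trans (add_le_add (hC₂ θ v) (hI θ))
  have e3 : |v| ^ k ≤ 1 + |v| ^ (l + 1) := by
    rcases le_total |v| 1 with hv | hv
    · have := pow_le_one₀ (n := k) (abs_nonneg v) hv
      have : 0 ≤ |v| ^ (l + 1) := by positivity
      linarith
    · linarith [pow_le_pow_right₀ hv hk]
  have e4 := mul_le_mul_of_nonneg_right e3 (norm_nonneg (iteratedDeriv l (hilbertRadon f θ) v))
  linarith

/-! ### Mixed derivatives in the angle and in `v` -/

/-- A trigonometric combination of transforms of fixed Schwartz functions. -/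
def trigHilbertRadon (f₁ f₂ f₃ : 𝓢(Plane, ℂ)) (θ v : ℝ) : ℂ :=
  hilbertRadon f₁ θ v + (Real.cos θ * hilbertRadon f₂ θ v + Real.sin θ * hilbertRadon f₃ θ v)

/-- The product rule rotates the pair `(cos, sin)`, so these combinations are closed under `∂_θ`.
This handles the dependence of `D_θ f₀` on the angle while keeping the Schwartz functions themselves
fixed. -/
lemma hasDerivAt_trigHilbertRadon_angle (f₁ f₂ f₃ : 𝓢(Plane, ℂ)) (θ v : ℝ) :
    HasDerivAt (fun θ => trigHilbertRadon f₁ f₂ f₃ θ v)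
      (trigHilbertRadon (rotDeriv f₁) (rotDeriv f₂ + f₃) (rotDeriv f₃ + (-1 : ℝ) • f₂) θ v) θ := by
  have hc := (Real.hasDerivAt_cos θ).ofReal_comp
  have hs := (Real.hasDerivAt_sin θ).ofReal_comp
  refine ((hasDerivAt_hilbertRadon_angle f₁ θ v).add
    ((hc.mul (hasDerivAt_hilbertRadon_angle f₂ θ v)).add
      (hs.mul (hasDerivAt_hilbertRadon_angle f₃ θ v)))).congr_deriv ?_
  simp only [trigHilbertRadon, hilbertRadon_add, hilbertRadon_smul]
  push_cast
  ring

lemma exists_iteratedDeriv_trigHilbertRadon_eq (f₁ f₂ f₃ : 𝓢(Plane, ℂ)) (m : ℕ) :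
    ∃ g₁ g₂ g₃ : 𝓢(Plane, ℂ), ∀ θ v,
      iteratedDeriv m (fun φ => trigHilbertRadon f₁ f₂ f₃ φ v) θ =
        trigHilbertRadon g₁ g₂ g₃ θ v := by
  induction m with
  | zero => exact ⟨f₁, f₂, f₃, fun θ v => by simp⟩
  | succ m ih =>
    obtain ⟨g₁, g₂, g₃, h⟩ := ih
    refine ⟨rotDeriv g₁, rotDeriv g₂ + g₃, rotDeriv g₃ + (-1 : ℝ) • g₂, fun θ v => ?_⟩
    rw [iteratedDeriv_succ, funext fun θ => h θ v]
    exact (hasDerivAt_trigHilbertRadon_angle g₁ g₂ g₃ θ v).deriv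

lemma contDiff_trigHilbertRadon (f₁ f₂ f₃ : 𝓢(Plane, ℂ)) :
    ContDiff ℝ ∞ fun p : ℝ × ℝ => trigHilbertRadon f₁ f₂ f₃ p.1 p.2 := by
  have hc : ContDiff ℝ ∞ fun p : ℝ × ℝ => (Real.cos p.1 : ℂ) :=
    Complex.ofRealCLM.contDiff.comp (Real.contDiff_cos.comp contDiff_fst)
  have hs : ContDiff ℝ ∞ fun p : ℝ × ℝ => (Real.sin p.1 : ℂ) :=
    Complex.ofRealCLM.contDiff.comp (Real.contDiff_sin.comp contDiff_fst)
  exact (contDiff_hilbertRadon f₁).add ((hc.mul (contDiff_hilbertRadon f₂)).add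
    (hs.mul (contDiff_hilbertRadon f₃)))

lemma exists_weighted_bound_trigHilbertRadon (f₁ f₂ f₃ : 𝓢(Plane, ℂ)) {k l : ℕ} (m : ℕ)
    (hk : k ≤ l + 1) :
    ∃ C, ∀ θ v : ℝ, (1 + |v| ^ k) * ‖iteratedDeriv l (fun w =>
      iteratedDeriv m (fun φ => trigHilbertRadon f₁ f₂ f₃ φ w) θ) v‖ ≤ C := by
  obtain ⟨g₁, g₂, g₃, h⟩ := exists_iteratedDeriv_trigHilbertRadon_eq f₁ f₂ f₃ m
  obtain ⟨C₁, hC₁⟩ := exists_weighted_bound_hilbertRadon g₁ hk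
  obtain ⟨C₂, hC₂⟩ := exists_weighted_bound_hilbertRadon g₂ hk
  obtain ⟨C₃, hC₃⟩ := exists_weighted_bound_hilbertRadon g₃ hk
  refine ⟨C₁ + (C₂ + C₃), fun θ v => ?_⟩
  have hd : ∀ g : 𝓢(Plane, ℂ), ContDiffAt ℝ l (hilbertRadon g θ) v := fun g =>
    ((contDiff_hilbertRadon_snd g θ).of_le (mod_cast le_top)).contDiffAt
  have e : iteratedDeriv l (fun w =>
      iteratedDeriv m (fun φ => trigHilbertRadon f₁ f₂ f₃ φ w) θ) v =
      iteratedDeriv l (hilbertRadon g₁ θ) v + (Real.cos θ * iteratedDeriv l (hilbertRadon g₂ θ) v +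
        Real.sin θ * iteratedDeriv l (hilbertRadon g₃ θ) v) := by
    rw [funext fun w => h θ w]
    unfold trigHilbertRadon
    rw [iteratedDeriv_fun_add (hd g₁)
      ((contDiffAt_const.mul (hd g₂)).add (contDiffAt_const.mul (hd g₃))),
      iteratedDeriv_fun_add (contDiffAt_const.mul (hd g₂)) (contDiffAt_const.mul (hd g₃)),
      iteratedDeriv_const_mul_field, iteratedDeriv_const_mul_field]
  rw [e]
  set a := iteratedDeriv l (hilbertRadon g₁ θ) v
  set b := iteratedDeriv l (hilbertRadon g₂ θ) v
  set c := iteratedDeriv l (hilbertRadon g₃ θ) v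
  have hb : ‖(Real.cos θ : ℂ) * b‖ ≤ ‖b‖ := by
    rw [norm_mul, Complex.norm_real]
    exact mul_le_of_le_one_left (norm_nonneg _) (Real.abs_cos_le_one θ)
  have hc : ‖(Real.sin θ : ℂ) * c‖ ≤ ‖c‖ := by
    rw [norm_mul, Complex.norm_real]
    exact mul_le_of_le_one_left (norm_nonneg _) (Real.abs_sin_le_one θ)
  have hsum : ‖a + (Real.cos θ * b + Real.sin θ * c)‖ ≤ ‖a‖ + (‖b‖ + ‖c‖) :=
    (norm_add_le _ _).trans (add_le_add le_rfl ((norm_add_le _ _).trans (add_le_add hb hc)))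
  have := mul_le_mul_of_nonneg_left hsum (show 0 ≤ 1 + |v| ^ k by positivity)
  linarith [hC₁ θ v, hC₂ θ v, hC₃ θ v]

-- Smoothness on the cylinder

attribute [local instance] finrank_real_complex_fact' in
lemma contMDiff_coe_circle : ContMDiff (𝓡 1) 𝓘(ℝ, ℂ) ∞ fun ζ : Circle => (ζ : ℂ) :=
  contMDiff_coe_sphere

/-- A function on the cylinder that is smooth in the angle is smooth. -/
lemma smoothOnCylinder_of_contDiff {h : Circle × ℝ → ℂ} {H : ℝ × ℝ → ℂ} (hH : ContDiff ℝ ∞ H)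
    (hh : ∀ θ v, h (Circle.exp θ, v) = H (θ, v)) : SmoothOnCylinder h := by
  rintro ⟨ζ, v⟩
  obtain ⟨θ, rfl⟩ := Circle.exp_surjective ζ
  -- The angle is recovered as `θ` plus the argument of `ζ e ^ (-iθ)`. This choice is valid on the
  -- whole circle and smooth near `e ^ (iθ)`, where the argument is evaluated near `1`, away from
  -- its cut.
  let G : ℂ × ℝ → ℂ := fun q =>
    H (θ + Complex.arg (q.1 * (Circle.exp (-θ) : ℂ)), q.2)
  have e : h = fun p : Circle × ℝ => G ((p.1 : ℂ), p.2) := by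
    funext p
    have h1 := hh (θ + Complex.arg ((p.1 * Circle.exp (-θ) : Circle) : ℂ)) p.2
    rw [Circle.exp_add, Circle.exp_arg, Circle.exp_neg, mul_inv_cancel_comm_assoc,
      ← Circle.exp_neg] at h1
    exact h1
  have hsm : ContMDiffAt ((𝓡 1).prod 𝓘(ℝ, ℝ)) 𝓘(ℝ, ℂ) ∞
      (fun p : Circle × ℝ => (p.1 : ℂ)) (Circle.exp θ, v) :=
    contMDiff_coe_circle.contMDiffAt.comp _ contMDiffAt_fst
  have hsnd : ContMDiffAt ((𝓡 1).prod 𝓘(ℝ, ℝ)) 𝓘(ℝ, ℝ) ∞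
      (fun p : Circle × ℝ => p.2) (Circle.exp θ, v) := contMDiffAt_snd
  have hout : ContDiffAt ℝ ∞ G ((Circle.exp θ : ℂ), v) := by
    have hone : (Circle.exp θ : ℂ) * (Circle.exp (-θ) : ℂ) = 1 := by
      rw [← Circle.coe_mul, ← Circle.exp_add, add_neg_cancel, Circle.exp_zero, Circle.coe_one]
    have hlog : ContDiffAt ℝ ∞ Complex.log ((Circle.exp θ : ℂ) * (Circle.exp (-θ) : ℂ)) := by
      rw [hone]
      exact (Complex.contDiffAt_log Complex.one_mem_slitPlane).restrict_scalars ℝ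
    have hlin : ContDiffAt ℝ ∞ (fun q : ℂ × ℝ => q.1 * (Circle.exp (-θ) : ℂ))
        ((Circle.exp θ : ℂ), v) := contDiffAt_fst.mul contDiffAt_const
    have harg : ContDiffAt ℝ ∞ (fun q : ℂ × ℝ => (Complex.log (q.1 * (Circle.exp (-θ) : ℂ))).im)
        ((Circle.exp θ : ℂ), v) :=
      Complex.imCLM.contDiff.contDiffAt.comp _ (ContDiffAt.comp
        (f := fun q : ℂ × ℝ => q.1 * (Circle.exp (-θ) : ℂ)) (g := Complex.log) _ hlog hlin)
    simp only [Complex.log_im] at harg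
    exact hH.contDiffAt.comp _ ((contDiffAt_const.add harg).prodMk contDiffAt_snd)
  rw [e]
  exact ContMDiffAt.comp (I' := 𝓘(ℝ, ℂ × ℝ)) (g := G) (f := fun p : Circle × ℝ => ((p.1 : ℂ), p.2))
    (Circle.exp θ, v) hout.contMDiffAt (hsm.prodMk_space hsnd)

/-! ### Interchange of integrals, antipodal parity and translation -/

lemma intervalIntegral_integral_swap_of_bound {G : ℝ → ℝ → ℂ} (S : Set ℝ) {C : ℝ} (a b : ℝ)
    (hG : Measurable (Function.uncurry G)) (hC : ∀ θ s, ‖G θ s‖ ≤ C * (1 + s ^ 2)⁻¹) :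
    ∫ θ in a..b, ∫ s in S, G θ s = ∫ s in S, ∫ θ in a..b, G θ s := by
  have : IsFiniteMeasure (volume.restrict (Set.uIoc a b)) := by rw [Set.uIoc]; infer_instance
  refine intervalIntegral_integral_swap ?_
  have hb : Integrable (fun p : ℝ × ℝ => (1 : ℝ) * (C * (1 + p.2 ^ 2)⁻¹))
      ((volume.restrict (Set.uIoc a b)).prod (volume.restrict S)) :=
    (integrable_const (1 : ℝ)).mul_prod
      (integrable_inv_one_add_sq.const_mul C).integrableOn.integrable
  exact hb.mono' hG.aestronglyMeasurable (ae_of_all _ fun p => (hC p.1 p.2).trans_eq (one_mul _).symm)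

lemma intervalIntegral_eq_zero_of_antiperiodic {p : ℝ → ℂ}
    (hp : ∀ θ, p (θ + Real.pi) = -p θ) : ∫ θ in (0 : ℝ)..(2 * Real.pi), p θ = 0 := by
  have hper : Function.Periodic p (2 * Real.pi) := fun θ => by
    rw [two_mul, ← add_assoc, hp, hp, neg_neg]
  have h1 : ∫ θ in (0 : ℝ)..(2 * Real.pi), p (θ + Real.pi) =
      ∫ θ in (0 : ℝ)..(2 * Real.pi), p θ := by
    rw [intervalIntegral.integral_comp_add_right, zero_add, add_comm (2 * Real.pi)]
    simpa using hper.intervalIntegral_add_eq Real.pi 0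
  simp only [hp, intervalIntegral.integral_neg] at h1
  exact self_eq_neg.1 h1.symm

lemma dirDeriv_add_pi (f : 𝓢(Plane, ℂ)) (θ : ℝ) :
    dirDeriv (θ + Real.pi) f = (-1 : ℝ) • dirDeriv θ f := by
  ext x
  simp [dirDeriv_apply, unitVec_add_pi]

/-- The pairs `(θ, v)` and `(θ + π, -v)` describe the same line, so the Radon transform is even
under this map, while the kernel `1 / s` is odd. -/
lemma hilbertRadon_add_pi (f : 𝓢(Plane, ℂ)) (θ v : ℝ) :
    hilbertRadon f (θ + Real.pi) (-v) = -hilbertRadon f θ v := by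
  rw [hilbertRadon, hilbertRadon, symHilbert, symHilbert, ← mul_neg, ← integral_neg]
  refine congrArg (fun z : ℂ => (1 / 2 : ℂ) * z) (integral_congr_ae (ae_of_all _ fun s => ?_))
  simp only [oddQuotient]
  rw [← radonAngle_add_pi f θ (v - s), ← radonAngle_add_pi f θ (v + s), ← neg_div]
  congr 1
  rw [show -v - s = -(v + s) by ring, show -v + s = -(v - s) by ring]
  ring

/-- The translate `y ↦ f (y + x)`. -/
def translate (x : Plane) (f : 𝓢(Plane, ℂ)) : 𝓢(Plane, ℂ) :=
  SchwartzMap.compSubConstCLM ℝ (-x) f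

lemma translate_apply (x y : Plane) (f : 𝓢(Plane, ℂ)) : translate x f y = f (y + x) := by
  simp [translate]

lemma dirDeriv_translate (x : Plane) (f : 𝓢(Plane, ℂ)) (θ : ℝ) :
    dirDeriv θ (translate x f) = translate x (dirDeriv θ f) := by
  ext y
  have h : (translate x f : Plane → ℂ) = fun y => f (y + x) := funext fun y => translate_apply x y f
  rw [dirDeriv_apply, translate_apply, dirDeriv_apply, h, fderiv_comp_add_right]

lemma eq_linePoint (θ : ℝ) (x : Plane) :
    x = linePoint θ (inner ℝ (unitVec θ) x) (inner ℝ (unitPerp θ) x) := by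
  ext i
  fin_cases i
  · simp only [Fin.zero_eta, linePoint_apply_zero]
    simp [unitVec, unitPerp, PiLp.inner_apply]
    linear_combination (-x 0) * Real.sin_sq_add_cos_sq θ
  · simp only [Fin.mk_one, linePoint_apply_one]
    simp [unitVec, unitPerp, PiLp.inner_apply]
    linear_combination (-x 1) * Real.sin_sq_add_cos_sq θ

/-- The component of `x` along the line is absorbed by translation invariance of the integral; the
normal component shifts `v`. This reduces Radon inversion to the origin. -/
lemma radonAngle_translate (x : Plane) (f : 𝓢(Plane, ℂ)) (θ v : ℝ) :
    radonAngle (translate x f) θ v = radonAngle f θ (inner ℝ (unitVec θ) x + v) := by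
  rw [radonAngle, radonAngle, ← integral_add_right_eq_self
    (fun s => f (linePoint θ (inner ℝ (unitVec θ) x + v) s)) (inner ℝ (unitPerp θ) x)]
  refine integral_congr_ae (ae_of_all _ fun s => ?_)
  simp only [translate_apply]
  have hx := eq_linePoint θ x
  generalize inner ℝ (unitVec θ) x = a at hx ⊢
  generalize inner ℝ (unitPerp θ) x = b at hx ⊢
  rw [hx]
  congr 1
  simp only [linePoint]
  module

lemma hilbertRadon_translate (x : Plane) (f : 𝓢(Plane, ℂ)) (θ : ℝ) :
    hilbertRadon (translate x f) θ 0 = hilbertRadon f θ (inner ℝ (unitVec θ) x) := by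
  simp only [hilbertRadon, symHilbert, oddQuotient, radonAngle_translate, zero_sub, zero_add,
    ← sub_eq_add_neg]

/-! ### Radon inversion in the plane -/

/-- The radial derivative of the angular integral of `f`. -/
def radialDeriv (f : 𝓢(Plane, ℂ)) (ρ : ℝ) : ℂ :=
  ∫ θ in (0 : ℝ)..(2 * Real.pi), dirDeriv θ f (linePoint θ ρ 0)

lemma continuous_dirDeriv_linePoint {X : Type*} [TopologicalSpace X] (f : 𝓢(Plane, ℂ))
    {a b c : X → ℝ} (ha : Continuous a) (hb : Continuous b) (hc : Continuous c) :
    Continuous fun x => dirDeriv (a x) f (linePoint (a x) (b x) (c x)) := by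
  have h0 : Continuous fun x => pderiv 0 f (linePoint (a x) (b x) (c x)) :=
    (pderiv 0 f).continuous.comp (Continuous.linePoint ha hb hc)
  have h1 : Continuous fun x => pderiv 1 f (linePoint (a x) (b x) (c x)) :=
    (pderiv 1 f).continuous.comp (Continuous.linePoint ha hb hc)
  simp only [dirDeriv, add_apply, smul_apply]
  fun_prop

lemma continuous_radonAngle_dirDeriv {X : Type*} [TopologicalSpace X] (f : 𝓢(Plane, ℂ))
    {a b : X → ℝ} (ha : Continuous a) (hb : Continuous b) :
    Continuous fun x => radonAngle (dirDeriv (a x) f) (a x) (b x) := by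
  have h0 : Continuous fun x => radonAngle (pderiv 0 f) (a x) (b x) :=
    (continuous_radonAngle (pderiv 0 f)).comp (ha.prodMk hb)
  have h1 : Continuous fun x => radonAngle (pderiv 1 f) (a x) (b x) :=
    (continuous_radonAngle (pderiv 1 f)).comp (ha.prodMk hb)
  simp only [dirDeriv, radonAngle_add, radonAngle_smul]
  fun_prop

/-- On each ray the integrand is the derivative of `f` along the ray, which integrates to `-f 0`;
Fubini then supplies the factor `2π`. -/
lemma integral_radialDeriv (f : 𝓢(Plane, ℂ)) :
    ∫ ρ in Set.Ioi (0 : ℝ), radialDeriv f ρ = -(2 * Real.pi) * f 0 := by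
  obtain ⟨C, -, hC⟩ := (BoundedFamily.const f).dirDeriv.exists_decayNorm
  have hbound : ∀ θ ρ, ‖dirDeriv θ f (linePoint θ ρ 0)‖ ≤ C * (1 + ρ ^ 2)⁻¹ := fun θ ρ => by
    refine (norm_schwartz_linePoint_le _ θ ρ 0).trans ?_
    simpa using mul_le_mul_of_nonneg_right (hC θ) (by positivity)
  have hcont : Continuous fun p : ℝ × ℝ => dirDeriv p.1 f (linePoint p.1 p.2 0) :=
    continuous_dirDeriv_linePoint f continuous_fst continuous_snd continuous_const
  have hray : ∀ θ, ∫ ρ in Set.Ioi (0 : ℝ), dirDeriv θ f (linePoint θ ρ 0) = -f 0 := fun θ => by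
    have hlim : Tendsto (fun ρ => f (linePoint θ ρ 0)) atTop (𝓝 0) := by
      have hf : Tendsto f (cocompact Plane) (𝓝 0) := f.tendsto_cocompact
      rw [← Metric.cobounded_eq_cocompact] at hf
      refine hf.comp (tendsto_norm_atTop_iff_cobounded.1 ?_)
      have e : ∀ ρ : ℝ, ‖linePoint θ ρ 0‖ = |ρ| := fun ρ => by
        rw [← abs_norm, ← sq_eq_sq_iff_abs_eq_abs, norm_sq_linePoint]; ring
      simp only [e]
      exact tendsto_abs_atTop_atTop
    rw [integral_Ioi_of_hasDerivAt_of_tendsto' (fun ρ _ => hasDerivAt_schwartz_linePoint f θ ρ 0)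
      ?_ hlim]
    · simp [linePoint]
    · exact ((integrable_inv_one_add_sq.const_mul C).mono'
        (continuous_dirDeriv_linePoint f continuous_const continuous_id
          continuous_const).aestronglyMeasurable
        (ae_of_all _ (hbound θ))).integrableOn
  unfold radialDeriv
  rw [← intervalIntegral_integral_swap_of_bound (Set.Ioi 0) 0 (2 * Real.pi)
    (G := fun θ ρ => dirDeriv θ f (linePoint θ ρ 0)) hcont.measurable hbound]
  simp [hray]

/-- With `(s, r) = ρ (cos α, sin α)`, the point runs round the circle of radius `ρ` while the
direction of differentiation lags by `α`. Its tangential component integrates to zero over the full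
circle, and the radial component carries the factor `cos α = s / ρ`. -/
lemma integral_dirDeriv_linePoint (f : 𝓢(Plane, ℂ)) {s r ρ : ℝ} (hρ : 0 < ρ)
    (h : ρ ^ 2 = s ^ 2 + r ^ 2) :
    ∫ θ in (0 : ℝ)..(2 * Real.pi), dirDeriv θ f (linePoint θ s r) =
      s * (radialDeriv f ρ / ρ) := by
  obtain ⟨α, hs, hr⟩ : ∃ α : ℝ, s = ρ * Real.cos α ∧ r = ρ * Real.sin α := by
    have hn : ‖(⟨s, r⟩ : ℂ)‖ = ρ := by
      rw [← abs_of_pos hρ, ← abs_norm, ← sq_eq_sq_iff_abs_eq_abs, Complex.sq_norm,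
        Complex.normSq_mk, h]
      ring
    refine ⟨Complex.arg ⟨s, r⟩, ?_, ?_⟩
    · rw [← hn, Complex.norm_mul_cos_arg]
    · rw [← hn, Complex.norm_mul_sin_arg]
  have hpt : ∀ θ, linePoint θ s r = linePoint (θ + α) ρ 0 := fun θ => by
    ext i
    fin_cases i
    · simp only [Fin.zero_eta, linePoint_apply_zero, Real.cos_add, hs, hr]; ring
    · simp only [Fin.mk_one, linePoint_apply_one, Real.sin_add, hs, hr]; ring
  set q : ℝ → ℂ := fun θ => dirDeriv (θ - α) f (linePoint θ ρ 0) with hq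
  have hper : Function.Periodic q (2 * Real.pi) := fun θ => by
    simp [hq, dirDeriv_apply, linePoint, unitVec, add_sub_right_comm]
  have hrot : ∀ θ, q θ = Real.cos α * dirDeriv θ f (linePoint θ ρ 0) +
      (-(Real.sin α / ρ) : ℂ) * rotDeriv f (linePoint θ ρ 0) := fun θ => by
    have hu : unitVec (θ - α) = Real.cos α • unitVec θ + (-Real.sin α) • unitPerp θ := by
      ext i
      fin_cases i <;> simp [unitVec, unitPerp, Real.cos_sub, Real.sin_sub] <;> ring
    have hρ' : (ρ : ℂ) ≠ 0 := Complex.ofReal_ne_zero.2 hρ.ne'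
    rw [hq]
    simp only [rotDeriv_linePoint, dirDeriv_apply, hu, map_add, map_smul, zero_smul, sub_zero,
      Complex.real_smul]
    push_cast
    field_simp
  have hc1 : Continuous fun θ => dirDeriv θ f (linePoint θ ρ 0) :=
    continuous_dirDeriv_linePoint f continuous_id continuous_const continuous_const
  have hc2 : Continuous fun θ => rotDeriv f (linePoint θ ρ 0) := by fun_prop
  have hzero : ∫ θ in (0 : ℝ)..(2 * Real.pi), rotDeriv f (linePoint θ ρ 0) = 0 := by
    rw [intervalIntegral.integral_eq_sub_of_hasDerivAt
      (fun θ _ => hasDerivAt_schwartz_linePoint_angle f θ ρ 0) (hc2.intervalIntegrable _ _)]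
    simp [linePoint, unitVec]
  have h1 : ∫ θ in (0 : ℝ)..(2 * Real.pi), dirDeriv θ f (linePoint θ s r) =
      ∫ θ in (0 : ℝ)..(2 * Real.pi), q (θ + α) := by
    simp [hq, hpt]
  have h2 : ∫ θ in (0 : ℝ)..(2 * Real.pi), q (θ + α) = ∫ θ in (0 : ℝ)..(2 * Real.pi), q θ := by
    rw [intervalIntegral.integral_comp_add_right, zero_add, add_comm (2 * Real.pi)]
    simpa using hper.intervalIntegral_add_eq α 0
  have hρ' : (ρ : ℂ) ≠ 0 := Complex.ofReal_ne_zero.2 hρ.ne'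
  rw [h1, h2]
  simp only [hrot]
  rw [intervalIntegral.integral_add ((hc1.intervalIntegrable _ _).const_mul _)
    ((hc2.intervalIntegrable _ _).const_mul _), intervalIntegral.integral_const_mul,
    intervalIntegral.integral_const_mul, hzero, hs, ← radialDeriv]
  push_cast
  field_simp
  ring

lemma integrableOn_radialDeriv (f : 𝓢(Plane, ℂ)) : IntegrableOn (radialDeriv f) (Set.Ioi 0) := by
  obtain ⟨C, -, hC⟩ := (BoundedFamily.const f).dirDeriv.exists_decayNorm
  have hcont : Continuous (radialDeriv f) := by
    refine intervalIntegral.continuous_parametric_intervalIntegral_of_continuous' ?_ _ _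
    exact continuous_dirDeriv_linePoint f continuous_snd continuous_fst continuous_const
  refine Integrable.integrableOn ((integrable_inv_one_add_sq.const_mul
    (C * |2 * Real.pi - 0|)).mono' hcont.aestronglyMeasurable (ae_of_all _ fun ρ => ?_))
  refine (intervalIntegral.norm_integral_le_of_norm_le_const (C := C * (1 + ρ ^ 2)⁻¹)
    fun θ _ => ?_).trans_eq (by ring)
  refine (norm_schwartz_linePoint_le _ θ ρ 0).trans ?_
  simpa using mul_le_mul_of_nonneg_right (hC θ) (by positivity)

/-- Polar coordinates, with `ℝ × ℝ` identified with `ℂ`: the Jacobian `ρ` cancels the denominator.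
-/
lemma integral_integral_radial (n : ℝ → ℂ) (hn : IntegrableOn n (Set.Ioi 0)) :
    ∫ s : ℝ, ∫ r : ℝ, n √(s ^ 2 + r ^ 2) / (√(s ^ 2 + r ^ 2) : ℝ) =
      2 * Real.pi * ∫ ρ in Set.Ioi (0 : ℝ), n ρ := by
  have e : ∀ ρ ∈ Set.Ioi (0 : ℝ), ρ ^ (Module.finrank ℝ ℂ - 1) • (n ρ / (ρ : ℂ)) = n ρ := by
    intro ρ hρ
    have hρ' : (ρ : ℂ) ≠ 0 := Complex.ofReal_ne_zero.2 (ne_of_gt hρ)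
    rw [Complex.finrank_real_complex, Complex.real_smul]
    push_cast
    field_simp
  have hi : Integrable (fun z : ℂ => n ‖z‖ / (‖z‖ : ℂ)) :=
    (integrable_fun_norm_addHaar volume (f := fun ρ : ℝ => n ρ / (ρ : ℂ))).2
      (hn.congr_fun (fun ρ hρ => (e ρ hρ).symm) measurableSet_Ioi)
  have hI := integral_fun_norm_addHaar (E := ℂ) volume (fun ρ : ℝ => n ρ / (ρ : ℂ))
  rw [setIntegral_congr_fun measurableSet_Ioi e, Complex.finrank_real_complex, measureReal_def,
    Complex.volume_ball] at hI
  have hmp := Complex.volume_preserving_equiv_real_prod.symm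
  have hnorm : ∀ p : ℝ × ℝ, ‖Complex.measurableEquivRealProd.symm p‖ = √(p.1 ^ 2 + p.2 ^ 2) := by
    intro p
    rw [Complex.norm_def, Complex.normSq_apply, Complex.measurableEquivRealProd_symm_apply]
    simp [sq]
  have hi2 := (hmp.integrable_comp_emb (MeasurableEquiv.measurableEmbedding _)).2 hi
  have hI2 := hmp.integral_comp (MeasurableEquiv.measurableEmbedding _)
    (fun z : ℂ => n ‖z‖ / (‖z‖ : ℂ))
  simp only [Function.comp_def, hnorm] at hi2 hI2
  rw [← integral_prod (fun p : ℝ × ℝ => n √(p.1 ^ 2 + p.2 ^ 2) / (√(p.1 ^ 2 + p.2 ^ 2) : ℝ)) hi2]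
  rw [Measure.volume_eq_prod] at hI2
  rw [hI2, hI]
  simp
  ring

/-- The Radon inversion formula in the plane, at the origin. -/
lemma integral_hilbertRadon_dirDeriv_zero (f : 𝓢(Plane, ℂ)) :
    ∫ θ in (0 : ℝ)..(2 * Real.pi), hilbertRadon (dirDeriv θ f) θ 0 =
      4 * Real.pi ^ 2 * f 0 := by
  obtain ⟨A, B, hb⟩ := (BoundedFamily.const f).dirDeriv.hilbertBound
  obtain ⟨C, hC0, hC⟩ := (BoundedFamily.const f).dirDeriv.exists_decayNorm
  have hcont : ∀ s : ℝ, Continuous fun θ : ℝ => radonAngle (dirDeriv θ f) θ s :=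
    fun s => continuous_radonAngle_dirDeriv f continuous_id continuous_const
  have hmeas : Measurable (Function.uncurry fun θ s : ℝ =>
      oddQuotient (radonAngle (dirDeriv θ f) θ) 0 s) := by
    have h1 : Measurable fun p : ℝ × ℝ => radonAngle (dirDeriv p.1 f) p.1 (0 - p.2) :=
      (continuous_radonAngle_dirDeriv f continuous_fst (by fun_prop)).measurable
    have h2 : Measurable fun p : ℝ × ℝ => radonAngle (dirDeriv p.1 f) p.1 (0 + p.2) :=
      (continuous_radonAngle_dirDeriv f continuous_fst (by fun_prop)).measurable
    exact (h1.sub h2).div (Complex.measurable_ofReal.comp measurable_snd)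
  have hswap := intervalIntegral_integral_swap_of_bound Set.univ 0 (2 * Real.pi) hmeas
    fun θ s => (hb θ).norm_oddQuotient_le_of_abs_le (v := 0) (V := 0) (by simp) s
  simp only [setIntegral_univ] at hswap
  have hmean : ∀ s : ℝ, ∫ θ in (0 : ℝ)..(2 * Real.pi), radonAngle (dirDeriv θ f) θ s =
      ∫ r : ℝ, ∫ θ in (0 : ℝ)..(2 * Real.pi), dirDeriv θ f (linePoint θ s r) := fun s => by
    have hm : Continuous (Function.uncurry fun θ r : ℝ => dirDeriv θ f (linePoint θ s r)) :=
      continuous_dirDeriv_linePoint f continuous_fst continuous_const continuous_snd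
    have := intervalIntegral_integral_swap_of_bound Set.univ 0 (2 * Real.pi) (C := C) hm.measurable
      fun θ r => (norm_schwartz_linePoint_le' _ θ s r).trans
        (mul_le_mul_of_nonneg_right (hC θ) (by positivity))
    simpa only [setIntegral_univ, radonAngle] using this
  -- The Radon transform is even under the antipodal map and `D_θ` is odd, so the sum of the two
  -- integrands changes sign under `θ ↦ θ + π`.
  have hodd : ∀ s : ℝ, ∫ θ in (0 : ℝ)..(2 * Real.pi), radonAngle (dirDeriv θ f) θ (-s) =
      -∫ θ in (0 : ℝ)..(2 * Real.pi), radonAngle (dirDeriv θ f) θ s := fun s => by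
    have c1 := hcont (-s)
    have c2 := hcont s
    rw [← add_eq_zero_iff_eq_neg, ← intervalIntegral.integral_add (c1.intervalIntegrable _ _)
      (c2.intervalIntegrable _ _)]
    refine intervalIntegral_eq_zero_of_antiperiodic fun θ => ?_
    have h1 := radonAngle_add_pi (dirDeriv θ f) θ s
    have h2 := radonAngle_add_pi (dirDeriv θ f) θ (-s)
    rw [neg_neg] at h2
    rw [dirDeriv_add_pi, radonAngle_smul, radonAngle_smul, h1, h2]
    push_cast
    ring
  -- The factor `s` from `integral_dirDeriv_linePoint` cancels the singular `1 / s`, leaving a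
  -- radial integrand in the plane.
  have hinner : ∀ᵐ s : ℝ, ∫ θ in (0 : ℝ)..(2 * Real.pi),
      oddQuotient (radonAngle (dirDeriv θ f) θ) 0 s =
      -2 * ∫ r : ℝ, radialDeriv f √(s ^ 2 + r ^ 2) / (√(s ^ 2 + r ^ 2) : ℝ) := by
    filter_upwards [Measure.ae_ne volume (0 : ℝ)] with s hs
    have c1 := hcont (-s)
    have c2 := hcont s
    have hs' : (s : ℂ) ≠ 0 := Complex.ofReal_ne_zero.2 hs
    simp only [oddQuotient, zero_sub, zero_add, div_eq_mul_inv _ (s : ℂ)]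
    rw [intervalIntegral.integral_mul_const, intervalIntegral.integral_sub
      (c1.intervalIntegrable _ _) (c2.intervalIntegrable _ _), hodd, hmean]
    have hr : ∀ r : ℝ, ∫ θ in (0 : ℝ)..(2 * Real.pi), dirDeriv θ f (linePoint θ s r) =
        s * (radialDeriv f √(s ^ 2 + r ^ 2) / (√(s ^ 2 + r ^ 2) : ℝ)) := fun r =>
      integral_dirDeriv_linePoint f (Real.sqrt_pos.2 (by positivity)) (Real.sq_sqrt (by positivity))
    simp only [hr]
    rw [integral_const_mul]
    field_simp
    ring
  simp only [hilbertRadon, symHilbert]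
  rw [intervalIntegral.integral_const_mul, hswap, integral_congr_ae hinner, integral_const_mul,
    integral_integral_radial _ (integrableOn_radialDeriv f), integral_radialDeriv]
  ring

/-- The Radon inversion formula in the plane. -/
lemma integral_hilbertRadon_dirDeriv (f : 𝓢(Plane, ℂ)) (x : Plane) :
    ∫ θ in (0 : ℝ)..(2 * Real.pi), hilbertRadon (dirDeriv θ f) θ (inner ℝ (unitVec θ) x) =
      4 * Real.pi ^ 2 * f x := by
  have h := integral_hilbertRadon_dirDeriv_zero (translate x f)
  simpa only [dirDeriv_translate, hilbertRadon_translate, translate_apply, zero_add] using h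

lemma integral_hilbertRadon_eq_zero {F : ℝ → 𝓢(Plane, ℂ)} (hF : ∀ θ, F (θ + Real.pi) = F θ)
    (x : Plane) :
    ∫ θ in (0 : ℝ)..(2 * Real.pi), hilbertRadon (F θ) θ (inner ℝ (unitVec θ) x) = 0 :=
  intervalIntegral_eq_zero_of_antiperiodic fun θ => by
    rw [hF, unitVec_add_pi, inner_neg_left, hilbertRadon_add_pi]

/-! ### Smooth dependence of integrals on parameters -/

section Parametric

variable {E F : Type} [NormedAddCommGroup E] [NormedSpace ℝ E] [FiniteDimensional ℝ E]
  [NormedAddCommGroup F] [NormedSpace ℝ F]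

lemma hasFDerivAt_intervalIntegral_of_contDiff {Φ : E → ℝ → F}
    (hΦ : ContDiff ℝ ∞ (Function.uncurry Φ)) (a b : ℝ) (x : E) :
    HasFDerivAt (fun x => ∫ θ in a..b, Φ x θ)
      (∫ θ in a..b, fderiv ℝ (fun x => Φ x θ) x) x := by
  have hpair : ContDiff ℝ ∞ (Function.uncurry fun (p : E × ℝ) (x : E) => Φ x p.2) :=
    hΦ.comp (contDiff_snd.prodMk (contDiff_snd.comp contDiff_fst))
  have hd : Continuous fun p : E × ℝ => fderiv ℝ (fun x => Φ x p.2) p.1 :=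
    (hpair.fderiv (n := ∞) contDiff_fst (by simp)).continuous
  have hΦc : ∀ x, Continuous (Φ x) := fun x =>
    hΦ.continuous.comp (continuous_const.prodMk continuous_id)
  have hdc : ∀ x, Continuous fun θ => fderiv ℝ (fun x => Φ x θ) x := fun x =>
    hd.comp (continuous_const.prodMk continuous_id)
  obtain ⟨C, hC⟩ := ((isCompact_closedBall x 1).prod
    (isCompact_uIcc (a := a) (b := b))).exists_bound_of_continuousOn hd.continuousOn
  refine intervalIntegral.hasFDerivAt_integral_of_dominated_of_fderiv_le
    (F' := fun x θ => fderiv ℝ (fun x => Φ x θ) x) (bound := fun _ => C)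
    (Metric.closedBall_mem_nhds x one_pos)
    (Eventually.of_forall fun x => (hΦc x).aestronglyMeasurable)
    ((hΦc x).intervalIntegrable _ _) (hdc x).aestronglyMeasurable
    (ae_of_all _ fun θ hθ y hy => hC (y, θ) ⟨hy, Set.uIoc_subset_uIcc hθ⟩)
    intervalIntegrable_const (ae_of_all _ fun θ _ y _ => ?_)
  have : ContDiff ℝ ∞ fun x => Φ x θ := hΦ.comp (contDiff_id.prodMk contDiff_const)
  exact (this.differentiable (by simp) y).hasFDerivAt

end Parametric

/-- The target space varies in the induction because the differentiated integrand takes values in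
continuous linear maps. -/
lemma contDiff_nat_intervalIntegral {E : Type} [NormedAddCommGroup E] [NormedSpace ℝ E]
    [FiniteDimensional ℝ E] (n : ℕ) {F : Type} [NormedAddCommGroup F] [NormedSpace ℝ F]
    {Φ : E → ℝ → F} (hΦ : ContDiff ℝ ∞ (Function.uncurry Φ)) (a b : ℝ) :
    ContDiff ℝ n fun x => ∫ θ in a..b, Φ x θ := by
  induction n generalizing F with
  | zero => exact contDiff_zero.2 (continuous_iff_continuousAt.2 fun x =>
      (hasFDerivAt_intervalIntegral_of_contDiff hΦ a b x).continuousAt)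
  | succ n ih =>
    rw [Nat.cast_succ, contDiff_succ_iff_hasFDerivAt]
    refine ⟨_, ?_, hasFDerivAt_intervalIntegral_of_contDiff hΦ a b⟩
    refine ih (Φ := fun x θ => fderiv ℝ (fun x => Φ x θ) x) ?_
    have hpair : ContDiff ℝ ∞ (Function.uncurry fun (p : E × ℝ) (x : E) => Φ x p.2) :=
      hΦ.comp (contDiff_snd.prodMk (contDiff_snd.comp contDiff_fst))
    exact hpair.fderiv contDiff_fst (by simp)

lemma contDiff_intervalIntegral {E : Type} [NormedAddCommGroup E] [NormedSpace ℝ E]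
    [FiniteDimensional ℝ E] {F : Type} [NormedAddCommGroup F] [NormedSpace ℝ F]
    {Φ : E → ℝ → F} (hΦ : ContDiff ℝ ∞ (Function.uncurry Φ)) (a b : ℝ) :
    ContDiff ℝ ∞ fun x => ∫ θ in a..b, Φ x θ :=
  contDiff_infty.2 fun n => contDiff_nat_intervalIntegral n hΦ a b

/-! ### The wave operator on superpositions of plane waves -/

/-- The derivative of a function on space-time in the direction `a`. -/
def dirFDeriv {G : Type} [NormedAddCommGroup G] [NormedSpace ℝ G] (a : ℝ × Plane)
    (w : ℝ × Plane → G) (p : ℝ × Plane) : G := fderiv ℝ w p a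

lemma contDiff_dirFDeriv {G : Type} [NormedAddCommGroup G] [NormedSpace ℝ G] (a : ℝ × Plane)
    {w : ℝ × Plane → G} (hw : ContDiff ℝ ∞ w) : ContDiff ℝ ∞ (dirFDeriv a w) :=
  (hw.fderiv_right (by simp)).clm_apply contDiff_const

lemma dirFDeriv_sub (a : ℝ × Plane) {w z : ℝ × Plane → ℂ} (hw : ContDiff ℝ ∞ w)
    (hz : ContDiff ℝ ∞ z) :
    dirFDeriv a (fun p => w p - z p) = fun p => dirFDeriv a w p - dirFDeriv a z p := by
  funext p
  simp only [dirFDeriv]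
  rw [fderiv_fun_sub (hw.differentiable (by simp) p) (hz.differentiable (by simp) p)]
  rfl

/-- The unit vector in the time direction. -/
def timeDir : ℝ × Plane := (1, 0)

/-- The unit vectors in the space directions. -/
def spaceDir (i : Fin 2) : ℝ × Plane := (0, EuclideanSpace.single i 1)

lemma deriv_time_slice {w : ℝ × Plane → ℂ} (hw : Differentiable ℝ w) (t : ℝ) (x : Plane) :
    deriv (fun s => w (s, x)) t = dirFDeriv timeDir w (t, x) := by
  have h : HasDerivAt (fun s : ℝ => (s, x)) timeDir t :=
    (hasDerivAt_id t).prodMk (hasDerivAt_const t x)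
  exact ((hw (t, x)).hasFDerivAt.comp_hasDerivAt t h).deriv

lemma fderiv_space_slice {G : Type} [NormedAddCommGroup G] [NormedSpace ℝ G]
    {w : ℝ × Plane → G} (hw : Differentiable ℝ w) (t : ℝ) (x : Plane) (i : Fin 2) :
    fderiv ℝ (fun y => w (t, y)) x (EuclideanSpace.single i 1) =
      dirFDeriv (spaceDir i) w (t, x) := by
  have h : HasFDerivAt (fun y : Plane => (t, y)) (ContinuousLinearMap.inr ℝ ℝ Plane) x :=
    (hasFDerivAt_const t x).prodMk (hasFDerivAt_id x)
  have := ((hw (t, x)).hasFDerivAt.comp x h).fderiv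
  rw [Function.comp_def] at this
  rw [this]
  simp [dirFDeriv, spaceDir]

/-- Derivatives of slices become directional derivatives on space-time, so that time and space
derivatives obey one calculus and commute in the energy argument. -/
lemma waveOp_eq {u : ℝ × Plane → ℂ} (hu : ContDiff ℝ ∞ u) (t : ℝ) (x : Plane) :
    waveOp u t x = dirFDeriv timeDir (dirFDeriv timeDir u) (t, x) -
      (dirFDeriv (spaceDir 0) (dirFDeriv (spaceDir 0) u) (t, x) +
        dirFDeriv (spaceDir 1) (dirFDeriv (spaceDir 1) u) (t, x)) := by
  have hd : Differentiable ℝ u := hu.differentiable (by simp)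
  have hslice : ContDiff ℝ ∞ fun y => u (t, y) := hu.comp (contDiff_const.prodMk contDiff_id)
  rw [waveOp]
  congr 1
  · rw [iteratedDeriv_succ, iteratedDeriv_one, funext fun s => deriv_time_slice hd s x]
    exact deriv_time_slice ((contDiff_dirFDeriv _ hu).differentiable (by simp)) t x
  · rw [InnerProductSpace.laplacian_eq_iteratedFDeriv_orthonormalBasis _
      (EuclideanSpace.basisFun (Fin 2) ℝ)]
    have h : ∀ i : Fin 2, iteratedFDeriv ℝ 2 (fun y => u (t, y)) x
        ![EuclideanSpace.basisFun (Fin 2) ℝ i, EuclideanSpace.basisFun (Fin 2) ℝ i] =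
        dirFDeriv (spaceDir i) (dirFDeriv (spaceDir i) u) (t, x) := fun i => by
      rw [iteratedFDeriv_two_apply, ← fderiv_space_slice
        ((contDiff_dirFDeriv _ hu).differentiable (by simp)) t x i,
        ← funext fun y => fderiv_space_slice hd t y i]
      have hd2 : DifferentiableAt ℝ (fderiv ℝ fun y => u (t, y)) x :=
        (hslice.fderiv_right (m := ∞) (by simp)).differentiable (by simp) x
      rw [fderiv_clm_apply hd2 (differentiableAt_const _)]
      simp
    simp only [h, Fin.sum_univ_two]

/-- The integral over the angle of a superposition of plane waves. -/
def planeWaveIntegral (H : ℝ → ℝ → ℂ) (p : ℝ × Plane) : ℂ :=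
  ∫ θ in (0 : ℝ)..(2 * Real.pi), H θ (p.1 + inner ℝ (unitVec θ) p.2)

lemma contDiff_inner_unitVec :
    ContDiff ℝ ∞ fun q : (ℝ × Plane) × ℝ => q.1.1 + inner ℝ (unitVec q.2) q.1.2 := by
  have h : ContDiff ℝ ∞ unitVec := by
    refine (PiLp.continuousLinearEquiv 2 ℝ fun _ : Fin 2 => ℝ).symm.contDiff.comp
      (contDiff_pi.2 fun i => ?_)
    fin_cases i
    · exact Real.contDiff_cos
    · exact Real.contDiff_sin
  exact (contDiff_fst.comp contDiff_fst).add
    ((h.comp contDiff_snd).inner ℝ (contDiff_snd.comp contDiff_fst))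

lemma contDiff_planeWave {H : ℝ → ℝ → ℂ} (hH : ContDiff ℝ ∞ (Function.uncurry H)) :
    ContDiff ℝ ∞ (Function.uncurry fun (p : ℝ × Plane) (θ : ℝ) =>
      H θ (p.1 + inner ℝ (unitVec θ) p.2)) :=
  hH.comp (contDiff_snd.prodMk contDiff_inner_unitVec)

lemma contDiff_planeWaveIntegral {H : ℝ → ℝ → ℂ} (hH : ContDiff ℝ ∞ (Function.uncurry H)) :
    ContDiff ℝ ∞ (planeWaveIntegral H) :=
  contDiff_intervalIntegral (contDiff_planeWave hH) _ _

lemma contDiff_uncurry_deriv {H : ℝ → ℝ → ℂ} (hH : ContDiff ℝ ∞ (Function.uncurry H)) :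
    ContDiff ℝ ∞ (Function.uncurry fun θ v => deriv (H θ) v) := by
  have hpair : ContDiff ℝ ∞ (Function.uncurry fun (p : ℝ × ℝ) (v : ℝ) => H p.1 v) :=
    hH.comp ((contDiff_fst.comp contDiff_fst).prodMk contDiff_snd)
  exact (hpair.fderiv (n := ∞) contDiff_snd (by simp)).clm_apply
    (contDiff_const (c := (1 : ℝ)))

/-- The derivative of a plane wave phase in the direction `a`. -/
def phaseDeriv (a : ℝ × Plane) (θ : ℝ) : ℝ := a.1 + inner ℝ (unitVec θ) a.2

lemma contDiff_phaseDeriv (a : ℝ × Plane) : ContDiff ℝ ∞ (phaseDeriv a) :=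
  contDiff_inner_unitVec.comp (contDiff_const.prodMk contDiff_id)

lemma contDiff_uncurry_phaseDeriv_mul_deriv {H : ℝ → ℝ → ℂ}
    (hH : ContDiff ℝ ∞ (Function.uncurry H)) (a : ℝ × Plane) :
    ContDiff ℝ ∞ (Function.uncurry fun θ v => (phaseDeriv a θ : ℂ) * deriv (H θ) v) :=
  (Complex.ofRealCLM.contDiff.comp ((contDiff_phaseDeriv a).comp contDiff_fst)).mul
    (contDiff_uncurry_deriv hH)

lemma dirFDeriv_planeWaveIntegral {H : ℝ → ℝ → ℂ} (hH : ContDiff ℝ ∞ (Function.uncurry H))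
    (a : ℝ × Plane) :
    dirFDeriv a (planeWaveIntegral H) =
      planeWaveIntegral fun θ v => (phaseDeriv a θ : ℂ) * deriv (H θ) v := by
  funext p
  have hΦ := contDiff_planeWave hH
  have hpair : ContDiff ℝ ∞ (Function.uncurry fun (θ : ℝ) (p : ℝ × Plane) =>
      H θ (p.1 + inner ℝ (unitVec θ) p.2)) := hΦ.comp (contDiff_snd.prodMk contDiff_fst)
  have hc : Continuous fun θ : ℝ => fderiv ℝ (fun p : ℝ × Plane =>
      H θ (p.1 + inner ℝ (unitVec θ) p.2)) p :=
    (hpair.fderiv (n := ∞) (contDiff_const (c := p)) (by simp)).continuous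
  rw [dirFDeriv, show planeWaveIntegral H = fun p => ∫ θ in (0 : ℝ)..(2 * Real.pi),
    H θ (p.1 + inner ℝ (unitVec θ) p.2) from rfl,
    (hasFDerivAt_intervalIntegral_of_contDiff hΦ _ _ p).fderiv,
    ContinuousLinearMap.intervalIntegral_apply (hc.intervalIntegrable _ _)]
  refine intervalIntegral.integral_congr fun θ _ => ?_
  have hHθ : ContDiff ℝ ∞ (H θ) := hH.comp (contDiff_const.prodMk contDiff_id)
  have h1 : HasFDerivAt (fun p : ℝ × Plane => p.1 + inner ℝ (unitVec θ) p.2)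
      (ContinuousLinearMap.fst ℝ ℝ Plane +
        (innerSL ℝ (unitVec θ)).comp (ContinuousLinearMap.snd ℝ ℝ Plane)) p :=
    (hasFDerivAt_fst).add ((innerSL ℝ (unitVec θ)).hasFDerivAt.comp p hasFDerivAt_snd)
  have h2 := (hHθ.differentiable (by simp)
    (p.1 + inner ℝ (unitVec θ) p.2)).hasDerivAt.hasFDerivAt.comp p h1
  rw [Function.comp_def] at h2
  simp only
  rw [h2.fderiv]
  simp [phaseDeriv, add_mul]

/-- Two derivatives in the direction `a` multiply the second `v`-derivative of the profile by the
squared phase derivative, and `1 - cos² θ - sin² θ = 0`. -/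
lemma waveOp_planeWaveIntegral {H : ℝ → ℝ → ℂ} (hH : ContDiff ℝ ∞ (Function.uncurry H))
    (t : ℝ) (x : Plane) : waveOp (planeWaveIntegral H) t x = 0 := by
  have hdd : ∀ a, dirFDeriv a (dirFDeriv a (planeWaveIntegral H)) (t, x) =
      ∫ θ in (0 : ℝ)..(2 * Real.pi), ((phaseDeriv a θ ^ 2 : ℝ) : ℂ) *
        deriv (deriv (H θ)) (t + inner ℝ (unitVec θ) x) := fun a => by
    rw [dirFDeriv_planeWaveIntegral hH, dirFDeriv_planeWaveIntegral
      (contDiff_uncurry_phaseDeriv_mul_deriv hH a)]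
    refine intervalIntegral.integral_congr fun θ _ => ?_
    simp only [deriv_const_mul_field]
    push_cast
    ring
  have hc : ∀ a, IntervalIntegrable (fun θ => ((phaseDeriv a θ ^ 2 : ℝ) : ℂ) *
      deriv (deriv (H θ)) (t + inner ℝ (unitVec θ) x)) volume 0 (2 * Real.pi) := fun a => by
    have h1 := ((contDiff_planeWave (contDiff_uncurry_deriv (contDiff_uncurry_deriv hH))).continuous
      ).comp ((continuous_const (y := ((t, x) : ℝ × Plane))).prodMk continuous_id)
    have h2 := (contDiff_phaseDeriv a).continuous
    exact ((Complex.continuous_ofReal.comp (h2.pow 2)).mul h1).intervalIntegrable _ _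
  rw [waveOp_eq (contDiff_planeWaveIntegral hH), hdd, hdd, hdd,
    ← intervalIntegral.integral_add (hc _) (hc _),
    ← intervalIntegral.integral_sub (hc _) ((hc _).add (hc _))]
  refine (intervalIntegral.integral_congr fun θ _ => ?_).trans intervalIntegral.integral_zero
  have h : (Real.cos θ : ℂ) ^ 2 + (Real.sin θ : ℂ) ^ 2 = 1 := mod_cast Real.cos_sq_add_sin_sq θ
  have e0 : phaseDeriv timeDir θ = 1 := by simp [phaseDeriv, timeDir]
  have e1 : phaseDeriv (spaceDir 0) θ = Real.cos θ := by
    simp [phaseDeriv, spaceDir, unitVec, PiLp.inner_apply]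
  have e2 : phaseDeriv (spaceDir 1) θ = Real.sin θ := by
    simp [phaseDeriv, spaceDir, unitVec, PiLp.inner_apply]
  simp only [e0, e1, e2, Complex.ofReal_pow, Complex.ofReal_one]
  linear_combination (-deriv (deriv (H θ)) (t + inner ℝ (unitVec θ) x)) * h

/-! ### Uniqueness for the Cauchy problem by a weighted energy -/

lemma dirFDeriv_comm {w : ℝ × Plane → ℂ} (hw : ContDiff ℝ ∞ w) (a b : ℝ × Plane) :
    dirFDeriv a (dirFDeriv b w) = dirFDeriv b (dirFDeriv a w) := by
  funext p
  have hd : DifferentiableAt ℝ (fderiv ℝ w) p :=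
    (hw.fderiv_right (m := ∞) (by simp)).differentiable (by simp) p
  have h : ∀ a b, dirFDeriv a (dirFDeriv b w) p = fderiv ℝ (fderiv ℝ w) p a b := fun a b => by
    change fderiv ℝ (fun q => fderiv ℝ w q b) p a = _
    rw [fderiv_clm_apply hd (differentiableAt_const _)]
    simp
  have hs : IsSymmSndFDerivAt ℝ w p := hw.contDiffAt.isSymmSndFDerivAt (by
    simpa using WithTop.coe_le_coe.2 (le_top : (2 : ℕ∞) ≤ ⊤))
  rw [h, h, hs.eq]

lemma dirFDeriv_add (a : ℝ × Plane) {f g : ℝ × Plane → ℝ} (hf : ContDiff ℝ ∞ f)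
    (hg : ContDiff ℝ ∞ g) (p : ℝ × Plane) :
    dirFDeriv a (fun p => f p + g p) p = dirFDeriv a f p + dirFDeriv a g p := by
  simp only [dirFDeriv]
  rw [fderiv_fun_add (hf.differentiable (by simp) p) (hg.differentiable (by simp) p)]
  rfl

lemma dirFDeriv_mul (a : ℝ × Plane) {f g : ℝ × Plane → ℝ} (hf : ContDiff ℝ ∞ f)
    (hg : ContDiff ℝ ∞ g) (p : ℝ × Plane) :
    dirFDeriv a (fun p => f p * g p) p = f p * dirFDeriv a g p + g p * dirFDeriv a f p := by
  simp only [dirFDeriv]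
  rw [fderiv_fun_mul (hf.differentiable (by simp) p) (hg.differentiable (by simp) p)]
  rfl

lemma dirFDeriv_inner (a : ℝ × Plane) {f g : ℝ × Plane → ℂ} (hf : ContDiff ℝ ∞ f)
    (hg : ContDiff ℝ ∞ g) (p : ℝ × Plane) :
    dirFDeriv a (fun p => inner ℝ (f p) (g p)) p =
      inner ℝ (f p) (dirFDeriv a g p) + inner ℝ (dirFDeriv a f p) (g p) :=
  fderiv_inner_apply ℝ (hf.differentiable (by simp) p) (hg.differentiable (by simp) p) a

section Support

variable {Q : ℝ × Plane → ℝ} {R : ℝ}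

lemma dirFDeriv_eq_zero_of_support (hs : ∀ t x, R + |t| < ‖x‖ → Q (t, x) = 0) (a : ℝ × Plane)
    {t : ℝ} {x : Plane} (h : R + |t| < ‖x‖) : dirFDeriv a Q (t, x) = 0 := by
  have ho : IsOpen {p : ℝ × Plane | R + |p.1| < ‖p.2‖} :=
    isOpen_lt (by fun_prop) (by fun_prop)
  have : Q =ᶠ[𝓝 (t, x)] fun _ => 0 := by
    filter_upwards [ho.mem_nhds h] with p hp using hs p.1 p.2 hp
  rw [dirFDeriv, this.fderiv_eq]
  simp

lemma hasCompactSupport_slice (hs : ∀ t x, R + |t| < ‖x‖ → Q (t, x) = 0) (t : ℝ) :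
    HasCompactSupport fun x => Q (t, x) :=
  HasCompactSupport.of_support_subset_isCompact (isCompact_closedBall 0 (R + |t|)) fun x hx => by
    by_contra hn
    exact hx (hs t x (by simpa using hn))

lemma integrable_slice (hQ : Continuous Q) (hs : ∀ t x, R + |t| < ‖x‖ → Q (t, x) = 0) (t : ℝ) :
    Integrable fun x => Q (t, x) :=
  (hQ.comp (continuous_const.prodMk continuous_id)).integrable_of_hasCompactSupport
    (hasCompactSupport_slice hs t)

lemma integral_dirFDeriv_spaceDir (hQ : ContDiff ℝ ∞ Q)
    (hs : ∀ t x, R + |t| < ‖x‖ → Q (t, x) = 0) (t : ℝ) (i : Fin 2) :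
    ∫ x, dirFDeriv (spaceDir i) Q (t, x) = 0 := by
  have hd : Differentiable ℝ fun x => Q (t, x) :=
    (hQ.comp (contDiff_const.prodMk contDiff_id)).differentiable (by simp)
  have hI := integrable_slice (contDiff_dirFDeriv (spaceDir i) hQ).continuous
    (fun t x h => dirFDeriv_eq_zero_of_support hs (spaceDir i) h) t
  have e := fun x => fderiv_space_slice (hQ.differentiable (by simp)) t x i
  have := integral_mul_fderiv_eq_neg_fderiv_mul_of_integrable (μ := volume) (𝕜 := ℝ)
    (f := fun _ : Plane => (1 : ℝ)) (g := fun x => Q (t, x)) (v := EuclideanSpace.single i (1 : ℝ))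
    (by simp) (by simpa [e] using hI) (by simpa using integrable_slice hQ.continuous hs t)
    (fun x _ => differentiableAt_const _) (fun x _ => hd x)
  simpa [e] using this

lemma hasDerivAt_integral_slice (hQ : ContDiff ℝ ∞ Q)
    (hs : ∀ t x, R + |t| < ‖x‖ → Q (t, x) = 0) (t : ℝ) :
    HasDerivAt (fun t => ∫ x, Q (t, x)) (∫ x, dirFDeriv timeDir Q (t, x)) t := by
  have hc : Continuous (dirFDeriv timeDir Q) := (contDiff_dirFDeriv timeDir hQ).continuous
  obtain ⟨C, hC⟩ := ((isCompact_closedBall t 1).prod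
    (isCompact_closedBall (0 : Plane) (R + (|t| + 1)))).exists_bound_of_continuousOn hc.continuousOn
  refine (hasDerivAt_integral_of_dominated_loc_of_deriv_le
    (F' := fun t x => dirFDeriv timeDir Q (t, x))
    (bound := Set.indicator (Metric.closedBall (0 : Plane) (R + (|t| + 1))) fun _ => C)
    (Metric.closedBall_mem_nhds t one_pos)
    (Eventually.of_forall fun t => (integrable_slice hQ.continuous hs t).aestronglyMeasurable)
    (integrable_slice hQ.continuous hs t)
    (hc.comp (continuous_const.prodMk continuous_id)).aestronglyMeasurable
    (ae_of_all _ fun x s hst => ?_) ?_ (ae_of_all _ fun x s _ => ?_)).2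
  · have h1 : |s - t| ≤ 1 := by simpa [Real.dist_eq] using hst
    by_cases hx : x ∈ Metric.closedBall (0 : Plane) (R + (|t| + 1))
    · rw [Set.indicator_of_mem hx]
      exact hC (s, x) ⟨hst, hx⟩
    · rw [Set.indicator_of_notMem hx, dirFDeriv_eq_zero_of_support hs, norm_zero]
      have h2 : R + (|t| + 1) < ‖x‖ := by simpa using hx
      linarith [abs_sub_abs_le_abs_sub s t]
  · exact (integrable_indicator_iff measurableSet_closedBall).2
      (integrableOn_const (measure_closedBall_lt_top.ne))
  · have h : HasDerivAt (fun s : ℝ => (s, x)) timeDir s :=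
      (hasDerivAt_id s).prodMk (hasDerivAt_const s x)
    exact (hQ.differentiable (by simp) (s, x)).hasFDerivAt.comp_hasDerivAt s h

end Support

/-- The weight `χ (R - σ t - √(1 + |x| ^ 2))`, supported in a backward or forward cone. -/
def coneWeight (σ R : ℝ) (p : ℝ × Plane) : ℝ :=
  expNegInvGlue (R - σ * p.1 - √(1 + ‖p.2‖ ^ 2))

lemma contDiff_sqrt_one_add_norm_sq : ContDiff ℝ ∞ fun p : ℝ × Plane => √(1 + ‖p.2‖ ^ 2) :=
  (contDiff_const.add (contDiff_snd.norm_sq ℝ)).sqrt fun p => by positivity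

lemma contDiff_coneWeight (σ R : ℝ) : ContDiff ℝ ∞ (coneWeight σ R) :=
  expNegInvGlue.contDiff.comp
    ((contDiff_const.sub (contDiff_const.mul contDiff_fst)).sub contDiff_sqrt_one_add_norm_sq)

/-- The smooth substitute `√(1 + |x|²)` for `|x|` dominates it, so every time slice of the weight
has compact support and spatial divergences integrate to zero. -/
lemma coneWeight_eq_zero {σ : ℝ} (hσ : |σ| = 1) {R t : ℝ} {x : Plane} (h : |R| + |t| < ‖x‖) :
    coneWeight σ R (t, x) = 0 := by
  refine expNegInvGlue.zero_of_nonpos ?_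
  have h1 : ‖x‖ ≤ √(1 + ‖x‖ ^ 2) := Real.le_sqrt_of_sq_le (by linarith)
  have h2 : -(σ * t) ≤ |t| := by
    refine (neg_le_abs _).trans_eq ?_
    rw [abs_mul, hσ, one_mul]
  simp only
  linarith [le_abs_self R]

lemma dirFDeriv_coneWeight (σ R : ℝ) (a p : ℝ × Plane) :
    dirFDeriv a (coneWeight σ R) p =
      -deriv expNegInvGlue (R - σ * p.1 - √(1 + ‖p.2‖ ^ 2)) *
        (σ * a.1 + inner ℝ p.2 a.2 / √(1 + ‖p.2‖ ^ 2)) := by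
  have hpos : (1 + ‖p.2‖ ^ 2) ≠ 0 := by positivity
  have h1 : HasFDerivAt (fun p : ℝ × Plane => 1 + ‖p.2‖ ^ 2)
      (2 • (innerSL ℝ p.2).comp (ContinuousLinearMap.snd ℝ ℝ Plane)) p :=
    (hasFDerivAt_snd.norm_sq).const_add 1
  have h2 := (Real.hasDerivAt_sqrt hpos).comp_hasFDerivAt p h1
  have h3 : HasFDerivAt (fun p : ℝ × Plane => R - σ * p.1)
      (-(σ • ContinuousLinearMap.fst ℝ ℝ Plane)) p :=
    (hasFDerivAt_fst.const_mul σ).const_sub R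
  have hχ : DifferentiableAt ℝ expNegInvGlue (R - σ * p.1 - √(1 + ‖p.2‖ ^ 2)) :=
    (expNegInvGlue.contDiff (n := 1)).differentiable (by simp) _
  have h4 := HasDerivAt.comp_hasFDerivAt p hχ.hasDerivAt (h3.sub h2)
  have h5 : HasFDerivAt (coneWeight σ R) _ p := h4
  rw [dirFDeriv, h5.fderiv]
  simp
  field_simp
  ring

/-- The energy density of a function on space-time. -/
def energyDensity (w : ℝ × Plane → ℂ) (p : ℝ × Plane) : ℝ :=
  inner ℝ (dirFDeriv timeDir w p) (dirFDeriv timeDir w p) +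
    (inner ℝ (dirFDeriv (spaceDir 0) w p) (dirFDeriv (spaceDir 0) w p) +
      inner ℝ (dirFDeriv (spaceDir 1) w p) (dirFDeriv (spaceDir 1) w p))

/-- Expand `|a - (y b + z c)|² ≥ 0` and apply Cauchy-Schwarz to `y b + z c`. -/
lemma two_mul_abs_le_energy (a b c : ℂ) {y z : ℝ} (h : y ^ 2 + z ^ 2 ≤ 1) :
    2 * (y * inner ℝ a b + z * inner ℝ a c) ≤
      inner ℝ a a + ((inner ℝ b b : ℝ) + inner ℝ c c) := by
  simp only [Complex.inner, Complex.mul_re, Complex.conj_re, Complex.conj_im]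
  have key : ∀ p q : ℝ, (y * p + z * q) ^ 2 ≤ p ^ 2 + q ^ 2 := fun p q => by
    nlinarith [sq_nonneg (y * q - z * p), mul_nonneg (sub_nonneg.2 h) (add_nonneg (sq_nonneg p) (sq_nonneg q))]
  nlinarith [key b.re c.re, key b.im c.im, sq_nonneg (a.re - (y * b.re + z * c.re)),
    sq_nonneg (a.im - (y * b.im + z * c.im))]

/-- By the wave equation, the time derivative of the energy density is twice the divergence of the
flux `w_t ∇w`. What remains comes from differentiating the weight: `-κ` times the energy density
minus twice the flux along `σ x / √(1 + |x|²)`. That vector has length at most `1` and `κ ≥ 0`, so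
the remainder is nonpositive. -/
lemma energy_identity_nonpos {w : ℝ × Plane → ℂ} (hw : ContDiff ℝ ∞ w)
    (hwave : ∀ p, dirFDeriv timeDir (dirFDeriv timeDir w) p =
      dirFDeriv (spaceDir 0) (dirFDeriv (spaceDir 0) w) p +
        dirFDeriv (spaceDir 1) (dirFDeriv (spaceDir 1) w) p)
    {σ : ℝ} (hσ : σ ^ 2 = 1) (R : ℝ) (p : ℝ × Plane) :
    σ * dirFDeriv timeDir (fun p => coneWeight σ R p * energyDensity w p) p ≤
      2 * σ * (dirFDeriv (spaceDir 0) (fun p => coneWeight σ R p *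
          inner ℝ (dirFDeriv timeDir w p) (dirFDeriv (spaceDir 0) w p)) p +
        dirFDeriv (spaceDir 1) (fun p => coneWeight σ R p *
          inner ℝ (dirFDeriv timeDir w p) (dirFDeriv (spaceDir 1) w p)) p) := by
  have h0 := contDiff_dirFDeriv timeDir hw
  have h1 := contDiff_dirFDeriv (spaceDir 0) hw
  have h2 := contDiff_dirFDeriv (spaceDir 1) hw
  have hφ := contDiff_coneWeight σ R
  have i0 := h0.inner ℝ h0
  have i1 := h1.inner ℝ h1
  have i2 := h2.inner ℝ h2
  have he : ContDiff ℝ ∞ (energyDensity w) := i0.add (i1.add i2)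
  have hde : dirFDeriv timeDir (energyDensity w) p =
      2 * (inner ℝ (dirFDeriv timeDir w p) (dirFDeriv timeDir (dirFDeriv timeDir w) p) +
        (inner ℝ (dirFDeriv (spaceDir 0) w p) (dirFDeriv timeDir (dirFDeriv (spaceDir 0) w) p) +
        inner ℝ (dirFDeriv (spaceDir 1) w p)
          (dirFDeriv timeDir (dirFDeriv (spaceDir 1) w) p))) := by
    unfold energyDensity
    rw [dirFDeriv_add _ i0 (i1.add i2), dirFDeriv_add _ i1 i2, dirFDeriv_inner _ h0 h0,
      dirFDeriv_inner _ h1 h1, dirFDeriv_inner _ h2 h2,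
      real_inner_comm (dirFDeriv timeDir w p), real_inner_comm (dirFDeriv (spaceDir 0) w p),
      real_inner_comm (dirFDeriv (spaceDir 1) w p)]
    ring
  rw [dirFDeriv_mul _ hφ he, dirFDeriv_mul _ hφ (h0.inner ℝ h1), dirFDeriv_mul _ hφ (h0.inner ℝ h2),
    dirFDeriv_inner _ h0 h1, dirFDeriv_inner _ h0 h2, hde, hwave, inner_add_right,
    dirFDeriv_comm hw timeDir (spaceDir 0), dirFDeriv_comm hw timeDir (spaceDir 1),
    real_inner_comm _ (dirFDeriv (spaceDir 0) (dirFDeriv timeDir w) p),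
    real_inner_comm _ (dirFDeriv (spaceDir 1) (dirFDeriv timeDir w) p),
    dirFDeriv_coneWeight, dirFDeriv_coneWeight, dirFDeriv_coneWeight]
  set κ := deriv expNegInvGlue (R - σ * p.1 - √(1 + ‖p.2‖ ^ 2))
  have hκ : 0 ≤ κ := expNegInvGlue.monotone.deriv_nonneg
  set J := √(1 + ‖p.2‖ ^ 2) with hJ
  have hJpos : 0 < J := Real.sqrt_pos.2 (by positivity)
  have hy : (σ * (p.2 0 / J)) ^ 2 + (σ * (p.2 1 / J)) ^ 2 ≤ 1 := by
    have hn : ‖p.2‖ ^ 2 = p.2 0 ^ 2 + p.2 1 ^ 2 := by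
      simp [EuclideanSpace.norm_sq_eq, Fin.sum_univ_two]
    have hJ2 : J ^ 2 = 1 + ‖p.2‖ ^ 2 := Real.sq_sqrt (by positivity)
    rw [mul_pow, mul_pow, hσ, one_mul, one_mul, div_pow, div_pow, ← add_div,
      div_le_one (by positivity), hJ2, hn]
    linarith
  have key := mul_le_mul_of_nonneg_left (two_mul_abs_le_energy (dirFDeriv timeDir w p)
    (dirFDeriv (spaceDir 0) w p) (dirFDeriv (spaceDir 1) w p) hy) hκ
  have e0 : (inner ℝ p.2 (spaceDir 0).2 : ℝ) = p.2 0 := by simp [spaceDir, PiLp.inner_apply]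
  have e1 : (inner ℝ p.2 (spaceDir 1).2 : ℝ) = p.2 1 := by simp [spaceDir, PiLp.inner_apply]
  have e2 : (inner ℝ p.2 timeDir.2 : ℝ) = 0 := by simp [timeDir]
  have e3 : timeDir.1 = 1 := rfl
  have e4 : ∀ i, (spaceDir i).1 = 0 := fun _ => rfl
  rw [e0, e1, e2, e3, e4, e4, energyDensity]
  simp only [zero_div, mul_zero, zero_add, add_zero, mul_one]
  linear_combination key - κ * (inner ℝ (dirFDeriv timeDir w p) (dirFDeriv timeDir w p) +
    (inner ℝ (dirFDeriv (spaceDir 0) w p) (dirFDeriv (spaceDir 0) w p) +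
      inner ℝ (dirFDeriv (spaceDir 1) w p) (dirFDeriv (spaceDir 1) w p))) * hσ

/-- The weighted energy is nonnegative, starts at zero and does not increase as `σ t` grows. The
sign `σ` treats future and past together. -/
lemma dirFDeriv_timeDir_eq_zero_of_energy {w : ℝ × Plane → ℂ} (hw : ContDiff ℝ ∞ w)
    (hwave : ∀ p, dirFDeriv timeDir (dirFDeriv timeDir w) p =
      dirFDeriv (spaceDir 0) (dirFDeriv (spaceDir 0) w) p +
        dirFDeriv (spaceDir 1) (dirFDeriv (spaceDir 1) w) p)
    (h0 : ∀ x, w (0, x) = 0) (h1 : ∀ x, dirFDeriv timeDir w (0, x) = 0)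
    {σ : ℝ} (hσ : σ ^ 2 = 1) {s : ℝ} (hs : 0 ≤ s) (x : Plane) :
    dirFDeriv timeDir w (σ * s, x) = 0 := by
  have hσ' : |σ| = 1 := by
    rw [← abs_one, ← sq_eq_sq_iff_abs_eq_abs, hσ, one_pow]
  -- With this radius the argument of the cutoff equals `1` at `(σ s, x)`, so the weight is positive
  -- at the point of interest.
  set R := s + √(1 + ‖x‖ ^ 2) + 1 with hR
  have d0 := contDiff_dirFDeriv timeDir hw
  have d1 := contDiff_dirFDeriv (spaceDir 0) hw
  have d2 := contDiff_dirFDeriv (spaceDir 1) hw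
  have hφ := contDiff_coneWeight σ R
  have he : ContDiff ℝ ∞ (energyDensity w) :=
    (d0.inner ℝ d0).add ((d1.inner ℝ d1).add (d2.inner ℝ d2))
  have he0 : ∀ p, 0 ≤ energyDensity w p := fun p =>
    add_nonneg real_inner_self_nonneg (add_nonneg real_inner_self_nonneg real_inner_self_nonneg)
  set Q : ℝ × Plane → ℝ := fun p => coneWeight σ R p * energyDensity w p with hQdef
  have hQ : ContDiff ℝ ∞ Q := hφ.mul he
  have hQ0 : ∀ p, 0 ≤ Q p := fun p => mul_nonneg (expNegInvGlue.nonneg _) (he0 p)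
  set P : Fin 2 → ℝ × Plane → ℝ := fun i p => coneWeight σ R p *
    inner ℝ (dirFDeriv timeDir w p) (dirFDeriv (spaceDir i) w p)
  have hP : ∀ i, ContDiff ℝ ∞ (P i) := fun i =>
    hφ.mul (d0.inner ℝ (contDiff_dirFDeriv (spaceDir i) hw))
  have hQs : ∀ t x, |R| + |t| < ‖x‖ → Q (t, x) = 0 := fun t x h => by
    simp only [hQdef]
    rw [coneWeight_eq_zero hσ' h, zero_mul]
  have hPs : ∀ i t x, |R| + |t| < ‖x‖ → P i (t, x) = 0 := fun i t x h => by
    change coneWeight σ R (t, x) * _ = 0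
    rw [coneWeight_eq_zero hσ' h, zero_mul]
  have hPi : ∀ i t, Integrable fun x => dirFDeriv (spaceDir i) (P i) (t, x) := fun i t =>
    integrable_slice (contDiff_dirFDeriv _ (hP i)).continuous
      (fun t x h => dirFDeriv_eq_zero_of_support (hPs i) _ h) t
  have hmono : Antitone fun r => ∫ x, Q (σ * r, x) := by
    refine antitone_of_hasDerivAt_nonpos
      (f' := fun r => (∫ x, dirFDeriv timeDir Q (σ * r, x)) * σ) (fun r => ?_) (fun r => ?_)
    · have h := (hasDerivAt_id r).const_mul σ
      rw [mul_one] at h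
      exact (hasDerivAt_integral_slice hQ hQs (σ * r)).comp r h
    · have hQi : Integrable fun x => dirFDeriv timeDir Q (σ * r, x) :=
        integrable_slice (contDiff_dirFDeriv _ hQ).continuous
          (fun t x h => dirFDeriv_eq_zero_of_support hQs _ h) _
      have hle := integral_mono (hQi.const_mul σ)
        (((hPi 0 (σ * r)).add (hPi 1 (σ * r))).const_mul (2 * σ))
        fun x => energy_identity_nonpos hw hwave hσ R (σ * r, x)
      have hz : ∫ x, 2 * σ * (dirFDeriv (spaceDir 0) (P 0) (σ * r, x) +
          dirFDeriv (spaceDir 1) (P 1) (σ * r, x)) = 0 := by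
        rw [integral_const_mul, integral_add (hPi 0 _) (hPi 1 _),
          integral_dirFDeriv_spaceDir (hP 0) (hPs 0),
          integral_dirFDeriv_spaceDir (hP 1) (hPs 1), add_zero, mul_zero]
      have hle' := hle.trans_eq hz
      rw [integral_const_mul, mul_comm] at hle'
      exact hle'
  have hspace : ∀ x i, dirFDeriv (spaceDir i) w (0, x) = 0 := fun x i => by
    rw [← fderiv_space_slice (hw.differentiable (by simp)) 0 x i]
    simp [h0]
  have hinit : ∫ x, Q (σ * 0, x) = 0 := by
    simp [hQdef, energyDensity, h1, hspace]
  have hzero : ∫ x, Q (σ * s, x) = 0 :=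
    le_antisymm ((hmono hs).trans_eq hinit) (integral_nonneg fun x => hQ0 _)
  have hcont : Continuous fun x => Q (σ * s, x) :=
    hQ.continuous.comp (continuous_const.prodMk continuous_id)
  rw [integral_eq_zero_iff_of_nonneg (fun x => hQ0 _)
    (integrable_slice hQ.continuous hQs _)] at hzero
  have hQx : Q (σ * s, x) = 0 :=
    congrFun ((Continuous.ae_eq_iff_eq volume hcont continuous_const).1 hzero) x
  have hpos : 0 < coneWeight σ R (σ * s, x) := by
    refine expNegInvGlue.pos_of_pos ?_
    have hs' : σ * (σ * s) = s := by rw [← mul_assoc, ← sq, hσ, one_mul]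
    simp only [hR, hs']
    linarith
  have hex := (mul_eq_zero.1 hQx).resolve_left hpos.ne'
  have h3 : (inner ℝ (dirFDeriv timeDir w (σ * s, x)) (dirFDeriv timeDir w (σ * s, x)) : ℝ) = 0 := by
    refine le_antisymm ?_ real_inner_self_nonneg
    rw [← hex, energyDensity]
    exact le_add_of_nonneg_right (add_nonneg real_inner_self_nonneg real_inner_self_nonneg)
  exact inner_self_eq_zero.1 h3

/-- A smooth solution of the wave equation with vanishing Cauchy data vanishes. -/
lemma eq_zero_of_waveOp_eq_zero {w : ℝ × Plane → ℂ} (hw : ContDiff ℝ ∞ w)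
    (hwave : ∀ p, dirFDeriv timeDir (dirFDeriv timeDir w) p =
      dirFDeriv (spaceDir 0) (dirFDeriv (spaceDir 0) w) p +
        dirFDeriv (spaceDir 1) (dirFDeriv (spaceDir 1) w) p)
    (h0 : ∀ x, w (0, x) = 0) (h1 : ∀ x, dirFDeriv timeDir w (0, x) = 0) (t : ℝ) (x : Plane) :
    w (t, x) = 0 := by
  have hd : Differentiable ℝ fun s => w (s, x) :=
    (hw.comp (contDiff_id.prodMk contDiff_const)).differentiable (by simp)
  -- It is enough that the time derivative vanishes: each time line is then constant and starts from
  -- zero.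
  rw [is_const_of_deriv_eq_zero hd (fun s => ?_) t 0, h0]
  rw [deriv_time_slice (hw.differentiable (by simp))]
  rcases le_total 0 s with hs | hs
  · simpa using dirFDeriv_timeDir_eq_zero_of_energy hw hwave h0 h1 (one_pow 2) hs x
  · simpa using dirFDeriv_timeDir_eq_zero_of_energy hw hwave h0 h1 (σ := -1) (by norm_num)
      (neg_nonneg.2 hs) x

/-! ### Matching the Cauchy data -/

lemma deriv_radon_exp (f : 𝓢(Plane, ℂ)) (θ v : ℝ) :
    deriv (radon f (Circle.exp θ)) v = radonAngle (dirDeriv θ f) θ v := by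
  rw [funext (radon_exp f θ)]
  exact (hasDerivAt_radonAngle f θ v).deriv

lemma hilbert_eq_symHilbert {g : Circle → ℝ → ℂ} {ζ : Circle} {A B : ℝ}
    (h : HilbertBound (g ζ) A B) (v : ℝ) :
    hilbert g ζ v = Complex.I / Real.pi * symHilbert (g ζ) v := by
  rw [hilbert, (h.hasPrincipalValue v).2.limUnder_eq]

lemma trigHilbertRadon_eq (f₀ f₁ : 𝓢(Plane, ℂ)) (θ v : ℝ) :
    trigHilbertRadon f₁ (pderiv 0 f₀) (pderiv 1 f₀) θ v =
      hilbertRadon (f₁ + dirDeriv θ f₀) θ v := by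
  rw [hilbertRadon_add, hilbertRadon_dirDeriv, trigHilbertRadon]

lemma continuous_hilbertRadon_ray (f : 𝓢(Plane, ℂ)) (x : Plane) :
    Continuous fun θ => hilbertRadon f θ (inner ℝ (unitVec θ) x) :=
  Continuous.comp (g := fun p : ℝ × ℝ => hilbertRadon f p.1 p.2)
    (f := fun θ => (θ, inner ℝ (unitVec θ) x)) (continuous_hilbertRadon f)
    (continuous_id.prodMk (continuous_unitVec.inner continuous_const))

lemma continuous_hilbertRadon_dirDeriv_ray (f : 𝓢(Plane, ℂ)) (x : Plane) :
    Continuous fun θ => hilbertRadon (dirDeriv θ f) θ (inner ℝ (unitVec θ) x) := by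
  simp only [hilbertRadon_dirDeriv]
  have h0 := continuous_hilbertRadon_ray (pderiv 0 f) x
  have h1 := continuous_hilbertRadon_ray (pderiv 1 f) x
  fun_prop

lemma dirDeriv_smul (θ c : ℝ) (f : 𝓢(Plane, ℂ)) : dirDeriv θ (c • f) = c • dirDeriv θ f := by
  simp only [dirDeriv, map_smul, smul_add]
  rw [smul_comm c (Real.cos θ), smul_comm c (Real.sin θ)]

lemma dirDeriv_add (θ : ℝ) (f g : 𝓢(Plane, ℂ)) :
    dirDeriv θ (f + g) = dirDeriv θ f + dirDeriv θ g := by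
  simp only [dirDeriv, map_add, smul_add]
  abel

lemma dirDeriv_dirDeriv_add_pi (f : 𝓢(Plane, ℂ)) (θ : ℝ) :
    dirDeriv (θ + Real.pi) (dirDeriv (θ + Real.pi) f) = dirDeriv θ (dirDeriv θ f) := by
  rw [dirDeriv_add_pi, dirDeriv_add_pi, dirDeriv_smul, smul_smul]
  norm_num

lemma continuous_hilbertRadon_dirDeriv_dirDeriv_ray (f : 𝓢(Plane, ℂ)) (x : Plane) :
    Continuous fun θ => hilbertRadon (dirDeriv θ (dirDeriv θ f)) θ (inner ℝ (unitVec θ) x) := by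
  have e : ∀ θ, dirDeriv θ (dirDeriv θ f) =
      Real.cos θ • dirDeriv θ (pderiv 0 f) + Real.sin θ • dirDeriv θ (pderiv 1 f) := fun θ => by
    conv_lhs => rw [show dirDeriv θ f = Real.cos θ • pderiv 0 f + Real.sin θ • pderiv 1 f from rfl]
    rw [dirDeriv_add, dirDeriv_smul, dirDeriv_smul]
  simp only [e, hilbertRadon_add, hilbertRadon_smul]
  have h0 := continuous_hilbertRadon_dirDeriv_ray (pderiv 0 f) x
  have h1 := continuous_hilbertRadon_dirDeriv_ray (pderiv 1 f) x
  fun_prop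

/-- The solution of the wave equation with prescribed Cauchy data, as a mean of plane waves. -/
lemma eq_planeWaveIntegral {u : ℝ × Plane → ℂ} (hu : ContDiff ℝ ∞ u)
    (hwave : ∀ t x, waveOp u t x = 0) (f₀ f₁ : 𝓢(Plane, ℂ)) (hf₀ : ∀ x, u (0, x) = f₀ x)
    (hf₁ : ∀ x, deriv (fun t => u (t, x)) 0 = f₁ x) (t : ℝ) (x : Plane) :
    u (t, x) = planeWaveIntegral (fun θ v => (1 / (4 * Real.pi ^ 2) : ℂ) *
      trigHilbertRadon f₁ (pderiv 0 f₀) (pderiv 1 f₀) θ v) (t, x) := by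
  set H : ℝ → ℝ → ℂ := fun θ v => (1 / (4 * Real.pi ^ 2) : ℂ) *
    trigHilbertRadon f₁ (pderiv 0 f₀) (pderiv 1 f₀) θ v with hHdef
  have hπ : (Real.pi : ℂ) ≠ 0 := Complex.ofReal_ne_zero.2 Real.pi_ne_zero
  have hH : ContDiff ℝ ∞ (Function.uncurry H) :=
    contDiff_const.mul (contDiff_trigHilbertRadon f₁ (pderiv 0 f₀) (pderiv 1 f₀))
  have hV := contDiff_planeWaveIntegral hH
  have hVwave := waveOp_planeWaveIntegral hH
  have hderiv : ∀ θ v, deriv (H θ) v = (1 / (4 * Real.pi ^ 2) : ℂ) *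
      (hilbertRadon (dirDeriv θ f₁) θ v + hilbertRadon (dirDeriv θ (dirDeriv θ f₀)) θ v) := by
    intro θ v
    have := (hasDerivAt_hilbertRadon (f₁ + dirDeriv θ f₀) θ v).const_mul
      (1 / (4 * Real.pi ^ 2) : ℂ)
    rw [dirDeriv_add, hilbertRadon_add] at this
    simp only [hHdef, trigHilbertRadon_eq]
    exact this.deriv
  -- Inversion recovers `f₀`, and the `f₁` term vanishes by antipodal parity.
  have hV0 : ∀ x, planeWaveIntegral H (0, x) = f₀ x := fun x => by
    simp only [planeWaveIntegral, hHdef, zero_add, trigHilbertRadon_eq, hilbertRadon_add]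
    rw [intervalIntegral.integral_const_mul, intervalIntegral.integral_add
      ((continuous_hilbertRadon_ray f₁ x).intervalIntegrable _ _)
      ((continuous_hilbertRadon_dirDeriv_ray f₀ x).intervalIntegrable _ _),
      integral_hilbertRadon_dirDeriv,
      integral_hilbertRadon_eq_zero (F := fun _ => f₁) (fun _ => rfl)]
    field_simp
    ring
  -- One more `D_θ` exchanges the roles: inversion now recovers `f₁`, while `D_θ D_θ f₀` is even in
  -- `ω` and its integral vanishes.
  have hV1 : ∀ x, dirFDeriv timeDir (planeWaveIntegral H) (0, x) = f₁ x := fun x => by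
    have hp : ∀ θ, phaseDeriv timeDir θ = 1 := fun θ => by simp [phaseDeriv, timeDir]
    rw [dirFDeriv_planeWaveIntegral hH]
    simp only [planeWaveIntegral, hp, hderiv, zero_add, Complex.ofReal_one, one_mul]
    rw [intervalIntegral.integral_const_mul, intervalIntegral.integral_add
      ((continuous_hilbertRadon_dirDeriv_ray f₁ x).intervalIntegrable _ _)
      ((continuous_hilbertRadon_dirDeriv_dirDeriv_ray f₀ x).intervalIntegrable _ _),
      integral_hilbertRadon_dirDeriv,
      integral_hilbertRadon_eq_zero (F := fun θ => dirDeriv θ (dirDeriv θ f₀))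
        (dirDeriv_dirDeriv_add_pi f₀)]
    field_simp
    ring
  refine sub_eq_zero.1 (eq_zero_of_waveOp_eq_zero (hu.sub hV) (fun p => ?_) (fun x => ?_)
    (fun x => ?_) t x)
  · have h1 := hwave p.1 p.2
    have h2 := hVwave p.1 p.2
    rw [waveOp_eq hu] at h1
    rw [waveOp_eq hV] at h2
    simp only [dirFDeriv_sub _ hu hV,
      dirFDeriv_sub _ (contDiff_dirFDeriv _ hu) (contDiff_dirFDeriv _ hV)]
    linear_combination h1 - h2
  · simp only [hf₀, hV0, sub_self]
  · rw [dirFDeriv_sub _ hu hV]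
    simp only [← deriv_time_slice (hu.differentiable (by simp)), hf₁, hV1, sub_self]

end

end CylinderWave

theorem mainTheorem3
    (u : ℝ × CylinderWave.Plane → ℂ) (hu : ContDiff ℝ ∞ u)
    (hwave : ∀ (t : ℝ) (x : CylinderWave.Plane), CylinderWave.waveOp u t x = 0)
    (f₀ f₁ : SchwartzMap CylinderWave.Plane ℂ)
    (hf₀ : ∀ x : CylinderWave.Plane, u (0, x) = f₀ x)
    (hf₁ : ∀ x : CylinderWave.Plane, deriv (fun t : ℝ => u (t, x)) 0 = f₁ x)
    (g : Circle → ℝ → ℂ)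
    (hg : ∀ (ζ : Circle) (v : ℝ),
      g ζ v = deriv (CylinderWave.radon f₀ ζ) v + CylinderWave.radon f₁ ζ v)
    (h : Circle × ℝ → ℂ)
    (hh : ∀ (ζ : Circle) (v : ℝ),
      h (ζ, v) = 1 / (2 * Complex.I) * CylinderWave.hilbert g ζ v) :
    (∀ (ζ : Circle) (v : ℝ), ∃ L : ℂ, CylinderWave.HasPrincipalValue (g ζ) v L) ∧
    CylinderWave.SmoothOnCylinder h ∧
    (∀ k l m : ℕ, k ≤ l + 1 → CylinderWave.WeightedBound h k l m) ∧
    ∀ (t : ℝ) (x : CylinderWave.Plane), u (t, x) = CylinderWave.circleTransform h t x := by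
  open CylinderWave in
  have hπ : (Real.pi : ℂ) ≠ 0 := Complex.ofReal_ne_zero.2 Real.pi_ne_zero
  have hgθ : ∀ θ, g (Circle.exp θ) = radonAngle (f₁ + dirDeriv θ f₀) θ := fun θ => by
    funext v
    rw [hg, deriv_radon_exp, radon_exp, radonAngle_add, add_comm]
  have hb : ∀ θ, HilbertBound (g (Circle.exp θ)) _ _ := fun θ => by
    rw [hgθ]; exact hilbertBound_radonAngle _ θ
  -- This is `(1 / 2i)(i / π)`. The mean over the circle contributes a second `1 / (2π)`, giving the
  -- `1 / (4π²)` of `eq_planeWaveIntegral`.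
  set c : ℂ := 1 / (2 * Real.pi) with hc
  have hθ : ∀ θ v, h (Circle.exp θ, v) =
      c * trigHilbertRadon f₁ (pderiv 0 f₀) (pderiv 1 f₀) θ v := fun θ v => by
    rw [hh, hilbert_eq_symHilbert (hb θ), hgθ, trigHilbertRadon_eq, ← hilbertRadon, hc]
    field_simp
  refine ⟨fun ζ v => ?_, ?_, fun k l m hk => ?_, fun t x => ?_⟩
  · obtain ⟨θ, rfl⟩ := Circle.exp_surjective ζ
    exact ⟨_, (hb θ).hasPrincipalValue v⟩
  · exact smoothOnCylinder_of_contDiff (contDiff_const.mul (contDiff_trigHilbertRadon _ _ _)) hθ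
  · obtain ⟨C, hC⟩ := exists_weighted_bound_trigHilbertRadon f₁ (pderiv 0 f₀) (pderiv 1 f₀) m hk
    refine ⟨‖c‖ * C, fun θ v => ?_⟩
    simp only [hθ, iteratedDeriv_const_mul_field, norm_mul]
    rw [mul_left_comm]
    exact mul_le_mul_of_nonneg_left (hC θ v) (norm_nonneg _)
  · rw [eq_planeWaveIntegral hu hwave f₀ f₁ hf₀ hf₁, circleTransform, planeWaveIntegral]
    simp only [hθ, dir_exp]
    rw [intervalIntegral.integral_const_mul, intervalIntegral.integral_const_mul, ← mul_assoc]
    congr 1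
    rw [hc]
    field_simp
    norm_num
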